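/- **Setting.** Let $d,P,K,b,T,S\in\mathbb N$ with $P,K,b,T\ge 1$. Worker $p\in[P]$ has a data distribution $D_p$ with finite support; $\ell(x,z)$ is a loss, $f_p(x)=\mathbb E_{z\sim D_p}\ell(x,z)$ and $f=\frac1P\sum_{p=1}^P f_p$ on $\mathbb R^d$. Put $I(k,t,s)=k+Kt+KTs$. Let $r>0$, $\eta>0$, $\widetilde x_0\in\mathbb R^d$, and let $(x_i)_{0\le i\le KTS}$ be the iterates of BVR-L-PSGD$(\widetilde x_0,\eta,b,K,T,S,r)$, that is: $x_0=\widetilde x_0+\eta\xi_{-1}$ and, for $0\le s<S$, $0\le t<T$, $0\le k<K$, $$x_{I(k+1,t,s)}=x_{I(k,t,s)}-\eta v_{I(k,t,s)}+\eta\,\xi_{I(k,t,s)},$$ where the $\xi_i$ are uniform on the Euclidean ball of radius $r$ centred at $0$ and $v_i$ is defined as follows. * $v^{(p)}_{I(0,0,s)}=\nabla f_p(x_{I(0,0,s)})$; for $t\ge1$, $v^{(p)}_{I(0,t,s)}=v^{(p)}_{I(0,t-1,s)}+\frac1{Kb}\sum_{l=1}^{Kb}\big(\nabla\ell(x_{I(0,t,s)},z_l)-\nabla\ell(x_{I(0,t-1,s)},z_l)\big)$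 with fresh samples $z_l\sim D_p$; and $v_{I(0,t,s)}=\frac1P\sum_p v^{(p)}_{I(0,t,s)}$. * In each round $(t,s)$ a worker $p_{t,s}$ is drawn uniformly from $[P]$, and for $1\le k<K$, $v_{I(k,t,s)}=v_{I(k-1,t,s)}+\frac1{b_k}\sum_{l=1}^{b_k}\big(\nabla\ell(x_{I(k,t,s)},z_l)-\nabla\ell(x_{I(k-1,t,s)},z_l)\big)$ with fresh samples $z_l\sim D_{p_{t,s}}$, where $b_k=\lceil\sqrt K\rceil b$ if $\lceil\sqrt K\rceil$ divides $k$ and $b_k=b$ otherwise. All perturbations, samples and worker selections are independent. **Assumptions.** (1) The $f_p$ are twice differentiable and $\|\nabla^2f_p(x)-\nabla^2f_{p'}(x)\|\le\zeta$ for all $p,p',x$. (2) For every $p$ and $z\in\mathrm{supp}(D_p)$, $\ell(\cdot,z)$ is differentiable with $L$-Lipschitz gradient, $L>0$. (3) $f$ has a global minimizer. (5) $\|\nabla\ell(x,z)\|\le G$ for all $x$, $p$ and $z\in\mathrm{supp}(D_p)$. **Proposition (Descent Lemma).** There are universal constants $c_\eta>0$, $C>0$, $m\in\mathbb N$ such that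 the following holds in every such setting. Let $q\in(0,1)$, $\Lambda=\log(3+L+G+K+b+T+S+1/r+1/q)$, and $$0<\eta\le\frac1{C\Lambda^m}\Big(\frac1L\wedge\frac1{K\zeta}\wedge\frac{\sqrt{b/K}}{L}\wedge\frac{\sqrt{Pb}}{\sqrt{KT}\,L}\Big)\qquad(1/(K\zeta)=\infty\text{ if }\zeta=0);$$ in particular $\eta$ may be chosen of order $\widetilde\Theta\big(\frac1L\wedge\frac1{K\zeta}\wedge\frac{\sqrt{b/K}}{L}\wedge\frac{\sqrt{Pb}}{\sqrt{KT}L}\big)$. Then with probability at least $1-3q$, simultaneously for all $k_0,k\in\{0,\dots,K\}$, $t_0,t\in\{0,\dots,T-1\}$, $s_0,s\in\{0,\dots,S-1\}$ with $I(k_0,t_0,s_0)\le I(k,t,s)$, $$f(x_{I(k,t,s)})\le f(x_{I(k_0,t_0,s_0)})-\frac\eta2\sum_{i=I(k_0,t_0,s_0)}^{I(k,t,s)-1}\|\nabla f(x_i)\|^2+\eta\Delta_Ir^2+R_1,$$ where $\Delta_I=I(k,t,s)-I(k_0,t_0,s_0)$ and $$R_1=-\frac1{4\eta}\sum_{i=I(k_0,t_0,s_0)}^{I(k,t,s)-1}\|x_{i+1}-x_i\|^2+\frac{c_\eta}\eta\Big(\frac{\Delta_I\wedge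 K}{K}\sum_{i=I(0,t_0,s_0)}^{I(k_0,t_0,s_0)-1}\|x_{i+1}-x_i\|^2+\frac{\Delta_I\wedge KT}{KT}\sum_{i=I(0,0,s_0)}^{I(0,t_0,s_0)-1}\|x_{i+1}-x_i\|^2\Big).$$ -/

import Mathlib

open MeasureTheory ProbabilityTheory

noncomputable section

namespace BVR

/-- The Euclidean space `ℝ^d`. -/
abbrev Vec (d : ℕ) : Type := EuclideanSpace ℝ (Fin d)

/-- `g` is `L`-gradient Lipschitz: it is differentiable and its gradient is `L`-Lipschitz. -/
def GradLipschitz {d : ℕ} (L : ℝ) (g : Vec d → ℝ) : Prop :=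
  Differentiable ℝ g ∧ ∀ x y, ‖gradient g x - gradient g y‖ ≤ L * ‖x - y‖

/-- The Hessian of `g` at `x`, as a linear operator on `ℝ^d`; its norm is the induced one. -/
def hessian {d : ℕ} (g : Vec d → ℝ) (x : Vec d) : Vec d →L[ℝ] Vec d :=
  fderiv ℝ (gradient g) x

/-- A distributed problem with `P` workers: the data distributions `D p` on the data space `Z`
and the loss `ℓ(x, z)`. -/
structure Problem (d P : ℕ) (Z : Type*) where
  D : Fin P → PMF Z
  loss : Vec d → Z → ℝ

namespace Problem

variable {d P : ℕ} {Z : Type*} (pb : Problem d P Z)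

/-- Offline setting: every data distribution has finite support. -/
def Offline : Prop := ∀ p, (pb.D p).support.Finite

/-- The local objective `f_p(x) = 𝔼_{z ∼ D_p} ℓ(x, z)`. -/
def localObj (p : Fin P) (x : Vec d) : ℝ := ∑' z, (pb.D p z).toReal * pb.loss x z

/-- The global objective `f = (1/P) ∑ₚ f_p`. -/
def obj (x : Vec d) : ℝ := (P : ℝ)⁻¹ * ∑ p, pb.localObj p x

/-- `∇ℓ(x, z)`, the gradient in `x`. -/
def lossGrad (x : Vec d) (z : Z) : Vec d := gradient (fun y => pb.loss y z) x

/-- Second-order `ζ`-heterogeneity of the (twice differentiable) local objectives. -/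
def Heterogeneous (ζ : ℝ) : Prop :=
  (∀ p, Differentiable ℝ (pb.localObj p) ∧ Differentiable ℝ (gradient (pb.localObj p))) ∧
    ∀ p p' x, ‖hessian (pb.localObj p) x - hessian (pb.localObj p') x‖ ≤ ζ

/-- `ℓ(·, z)` is `L`-gradient Lipschitz for all data points `z` of all workers. -/
def LossGradLipschitz (L : ℝ) : Prop :=
  ∀ p, ∀ z ∈ (pb.D p).support, GradLipschitz L (fun x => pb.loss x z)

/-- `f` has a global minimizer. -/
def HasMinimizer : Prop := ∃ xStar, ∀ x, pb.obj xStar ≤ pb.obj x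

/-- `∇ℓ(·, z)` is bounded by `G` for all data points `z` of all workers. -/
def LossGradBounded (G : ℝ) : Prop :=
  ∀ p, ∀ z ∈ (pb.D p).support, ∀ x, ‖pb.lossGrad x z‖ ≤ G

/-- The minibatch gradient `(1/m) ∑_{l < m} ∇ℓ(x, z_l)`. -/
def batchGrad (m : ℕ) (z : ℕ → Z) (x : Vec d) : Vec d :=
  (m : ℝ)⁻¹ • ∑ l ∈ Finset.range m, pb.lossGrad x (z l)

end Problem

/-- The flat iteration index `I(k, t, s) = k + K t + K T s`. -/
def idx (K T k t s : ℕ) : ℕ := k + K * t + K * T * s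

/-- The inputs of the algorithm. -/
structure Params (d : ℕ) where
  x₀ : Vec d
  η : ℝ
  b : ℕ
  K : ℕ
  T : ℕ

/-- The local minibatch size `b_k`: `⌈√K⌉ b` if `k ≡ 0 mod ⌈√K⌉`, and `b` otherwise. -/
def localBatch (K b k : ℕ) : ℕ :=
  if k % ⌈Real.sqrt K⌉₊ = 0 then ⌈Real.sqrt K⌉₊ * b else b

/-- One realization of all random draws of the algorithm.
* `ξ i` is the perturbation with which `x_i` is formed (`ξ 0` perturbs the initial point);
* `worker n` is the worker selected in communication round `n = t + T s`;
* `z p i l` is the `l`-th sample, from `D p`, available to worker `p` at iteration `i`.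
  At the start of a round every worker uses its own samples, and inside a round only the samples
  of the selected worker are ever looked at. -/
structure Draws (d P : ℕ) (Z : Type*) where
  ξ : ℕ → Vec d
  worker : ℕ → Fin P
  z : Fin P → ℕ → ℕ → Z

/-- The state of the algorithm at iteration `i = I(k, t, s)` with `k < K`, `t < T`:
the iterate `x_i`, the estimator `v_i`, the point `x_{I(0,t,s)}` at which the current round
started, and the workers' estimators `v^{(p)}_{I(0,t,s)}`. -/
structure State (d P : ℕ) where
  x : Vec d
  v : Vec d
  xRound : Vec d
  vWorker : Fin P → Vec d

section Algorithm

variable {d P : ℕ} {Z : Type*} (pb : Problem d P Z) (a : Params d) (u : Draws d P Z)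

/-- The server's average `(1/P) ∑ₚ v^{(p)}`. -/
def average (v : Fin P → Vec d) : Vec d := (P : ℝ)⁻¹ • ∑ p, v p

/-- State at the start of an epoch at the point `x`: full local gradients are used. -/
def epochStart (x : Vec d) : State d P :=
  let vW : Fin P → Vec d := fun p => gradient (pb.localObj p) x
  { x := x, v := average vW, xRound := x, vWorker := vW }

/-- State at the start, at the point `x` and iteration `i = I(0, t, s)` with `t ≥ 1`, of a round
inside an epoch, from the previous state: every worker updates its estimator with `K b` samples. -/
def roundStart (i : ℕ) (st : State d P) (x : Vec d) : State d P :=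
  let vW : Fin P → Vec d := fun p =>
    pb.batchGrad (a.K * a.b) (u.z p i) x - pb.batchGrad (a.K * a.b) (u.z p i) st.xRound
      + st.vWorker p
  { x := x, v := average vW, xRound := x, vWorker := vW }

/-- State at the point `x` and iteration `i = I(k, t, s)` with `1 ≤ k < K`, inside a round, from
the previous state: only the selected worker updates the estimator, with `b_k` samples. -/
def localUpdate (i : ℕ) (st : State d P) (x : Vec d) : State d P :=
  let zs : ℕ → Z := u.z (u.worker (i / a.K)) i
  let bk : ℕ := localBatch a.K a.b (i % a.K)
  { st with x := x, v := pb.batchGrad bk zs x - pb.batchGrad bk zs st.x + st.v }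

/-- The state of BVR-L-PSGD at each iteration `i = I(k, t, s)`. -/
def run : ℕ → State d P
  | 0 => epochStart pb (a.x₀ + a.η • u.ξ 0)
  | i + 1 =>
    let st := run i
    let x := (st.x - a.η • st.v) + a.η • u.ξ (i + 1)
    if a.K * a.T ∣ i + 1 then epochStart pb x
    else if a.K ∣ i + 1 then roundStart pb a u (i + 1) st x
    else localUpdate pb a u (i + 1) st x

/-- The iterate `x_i` of BVR-L-PSGD. -/
def iterate (i : ℕ) : Vec d := (run pb a u i).x

end Algorithm

/-- Labels of the elementary random draws. -/
inductive Source (P : ℕ) : Type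
  | noise (i : ℕ)
  | select (n : ℕ)
  | sample (p : Fin P) (i l : ℕ)

section Probability

variable {Ω : Type*} {d P : ℕ} {Z : Type*} [MeasurableSpace Z]

/-- The σ-algebra on `Ω` generated by one elementary draw. -/
@[reducible] def Source.sigma (U : Ω → Draws d P Z) : Source P → MeasurableSpace Ω
  | .noise i => MeasurableSpace.comap (fun ω => (U ω).ξ i) inferInstance
  | .select n => MeasurableSpace.comap (fun ω => (U ω).worker n) inferInstance
  | .sample p i l => MeasurableSpace.comap (fun ω => (U ω).z p i l) inferInstance

/-- The random draws `U` have the joint law prescribed by the algorithm: all elementary draws are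
mutually independent, perturbations are uniform on the ball of radius `r`, the selected workers
are uniform, and the samples of worker `p` follow `D p`. -/
structure IsSampling [MeasurableSpace Ω] (μ : Measure Ω) (pb : Problem d P Z) (r : ℝ)
    (U : Ω → Draws d P Z) : Prop where
  measurable_ξ : ∀ i, Measurable fun ω => (U ω).ξ i
  measurable_worker : ∀ n, Measurable fun ω => (U ω).worker n
  measurable_z : ∀ p i l, Measurable fun ω => (U ω).z p i l
  law_ξ : ∀ i, μ.map (fun ω => (U ω).ξ i) = cond volume (Metric.closedBall 0 r)
  law_worker : ∀ n, μ.map (fun ω => (U ω).worker n) = uniformOn Set.univ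
  law_z : ∀ p i l, μ.map (fun ω => (U ω).z p i l) = (pb.D p).toMeasure
  indep : iIndep (Source.sigma U) μ

end Probability

/-- The scale `1/L ∧ 1/(Kζ) ∧ √(b/K)/L ∧ √(Pb)/(√(KT) L)` of the step size, written as the
reciprocal of a maximum so that `1/(Kζ) = ∞` when `ζ = 0`. -/
def stepScale (L ζ : ℝ) (K b T P : ℕ) : ℝ :=
  (max (max L (K * ζ))
    (max (L * Real.sqrt ((K : ℝ) / b)) (L * Real.sqrt ((K * T : ℝ) / (P * b)))))⁻¹

/-- The logarithmic quantity whose powers are hidden in the order of the step size. -/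
def logFactor (L G : ℝ) (K b T S : ℕ) (r q : ℝ) : ℝ :=
  Real.log (3 + L + G + K + b + T + S + 1 / r + 1 / q)

/-- The descent inequality for the iterates `x`, between the indices `I(k₀, t₀, s₀)` and
`I(k, t, s)`. -/
def DescentIneq {d : ℕ} (f : Vec d → ℝ) (x : ℕ → Vec d) (η r cη : ℝ) (K T : ℕ)
    (k₀ t₀ s₀ k t s : ℕ) : Prop :=
  let i₀ := idx K T k₀ t₀ s₀
  let i₁ := idx K T k t s
  let Δ : ℕ := i₁ - i₀
  let step : ℕ → ℝ := fun i => ‖x (i + 1) - x i‖ ^ 2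
  let R₁ : ℝ :=
    -(1 / (4 * η)) * ∑ i ∈ Finset.Ico i₀ i₁, step i
      + cη / η *
        (((min Δ K : ℕ) : ℝ) / K * ∑ i ∈ Finset.Ico (idx K T 0 t₀ s₀) i₀, step i
          + ((min Δ (K * T) : ℕ) : ℝ) / ((K : ℝ) * T) *
            ∑ i ∈ Finset.Ico (idx K T 0 0 s₀) (idx K T 0 t₀ s₀), step i)
  f (x i₁) ≤ f (x i₀) - η / 2 * ∑ i ∈ Finset.Ico i₀ i₁, ‖gradient f (x i)‖ ^ 2
      + η * Δ * r ^ 2 + R₁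

end BVR

end

-- Descent with an inexact gradient v loses (η/2)‖∇f‖² and about ‖x_{i+1} - x_i‖²/(2η) per step, and
-- gains (3/2)η‖∇f - v‖² + (3/4)ηr² (`one_step_descent`). It remains to pay for the estimation error
-- ‖∇f - v‖² with squared displacements and the spare ηr²/4.
--
-- The error splits exactly (`estimator_eq`) into a drift and a sum M of centred sampling errors
-- collected since the last full gradient. The drift appears because inside a round one worker
-- stands in for the average; second-order heterogeneity bounds it by ζ times the distance to the
-- start of the round. M is a Hilbert-space martingale whose quadratic variation V is at most a
-- combination of the squared displacements in the current round and in the current epoch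
-- (`sum_stepVar_active_le_blockSum`).
--
-- V involves the very displacements to be compared with, so the concentration is self-normalized:
-- 𝔼[cosh(t‖M‖) exp(-t²V/2)] ≤ 1 for each fixed t (`lintegral_expMart_le_one`), free of the
-- dimension and of any a priori bound on V. A union bound over a geometric grid of t gives ‖M‖² ≤
-- 9l(V + β) for all iterations at once, with l of order Λ (`measure_noise_gt_le`). The floor β is
-- taken of order r²/l, so that the perturbation budget absorbs it.
--
-- On that event the rest is deterministic (`descentIneq_of_noise_le`). When the errors are summed
-- over a window of length Δ, a displacement recurs at most min(Δ, B) times within its block of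
-- length B = K or B = KT (`sum_blockSum_le`); this produces the weights in R₁. The step size makes
-- the coefficients small enough to leave -1/(4η) in front of the displacements inside the window.

open MeasureTheory ProbabilityTheory

noncomputable section

namespace BVR

-- Dimension-free exponential moments in a Hilbert space

section Cosh

/-- Convexity of `u ↦ cosh √u`, in the form of a two-point interpolation. -/
lemma cosh_le_interpolation {s a b w : ℝ} (hs0 : 0 ≤ s) (hs1 : s ≤ 1)
    (hw : w ^ 2 ≤ s * a ^ 2 + (1 - s) * b ^ 2) :
    Real.cosh w ≤ s * Real.cosh a + (1 - s) * Real.cosh b := by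
  -- In the series for cosh w every term (w²)ⁿ/(2n)! is a convex increasing function of w², so the
  -- comparison is made term by term.
  refine hasSum_le (fun n => ?_) (Real.hasSum_cosh w)
    (((Real.hasSum_cosh a).mul_left s).add ((Real.hasSum_cosh b).mul_left (1 - s)))
  have h1 : (w ^ 2) ^ n ≤ s * (a ^ 2) ^ n + (1 - s) * (b ^ 2) ^ n := by
    refine (pow_le_pow_left₀ (sq_nonneg w) hw n).trans ?_
    have := (convexOn_pow (𝕜 := ℝ) n).2 (x := a ^ 2) (y := b ^ 2) (sq_nonneg a) (sq_nonneg b)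
      hs0 (sub_nonneg.2 hs1) (by ring)
    simpa [smul_eq_mul] using this
  have h2 : (0 : ℝ) < (2 * n).factorial := by positivity
  rw [pow_mul, pow_mul, pow_mul, ← mul_div_assoc, ← mul_div_assoc, ← add_div]
  gcongr

variable {E : Type*} [NormedAddCommGroup E] [InnerProductSpace ℝ E]

/-- `cosh (t‖x + ·‖)` is dominated on a ball by an affine function. -/
lemma cosh_norm_add_le (t : ℝ) (x X : E) {c : ℝ} (hX : ‖X‖ ≤ c) :
    Real.cosh (t * ‖x + X‖) ≤ Real.cosh (t * ‖x‖) * Real.cosh (t * c)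
      + Real.sinh (t * ‖x‖) * Real.sinh (t * c) / (‖x‖ * c) * inner ℝ x X := by
  have hc : 0 ≤ c := (norm_nonneg X).trans hX
  have hn : ‖x + X‖ ^ 2 = ‖x‖ ^ 2 + 2 * inner ℝ x X + ‖X‖ ^ 2 := norm_add_sq_real x X
  have habs : |inner ℝ x X| ≤ ‖x‖ * c :=
    (abs_real_inner_le_norm x X).trans (by gcongr)
  have hX2 : ‖X‖ ^ 2 ≤ c ^ 2 := by gcongr
  -- When the denominator vanishes, the quotient is 0 by convention; the inner product and one of
  -- the two sinh factors vanish as well, so nothing is lost.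
  rcases eq_or_ne (‖x‖ * c) 0 with h0 | h0
  · have hi : inner ℝ x X = 0 := by rw [h0] at habs; exact abs_nonpos_iff.1 habs
    rw [hi, mul_zero, add_zero]
    have h3 : |t * ‖x + X‖| ≤ |t * ‖x‖ + t * c| := by
      rw [← sq_le_sq]
      nlinarith [mul_le_mul_of_nonneg_left hX2 (sq_nonneg t), sq_nonneg t]
    refine (Real.cosh_le_cosh.2 h3).trans ?_
    rw [Real.cosh_add]
    have : Real.sinh (t * ‖x‖) * Real.sinh (t * c) = 0 := by
      rcases mul_eq_zero.1 h0 with h | h <;> simp [h]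
    rw [this, add_zero]
  · have hpos : 0 < ‖x‖ * c := lt_of_le_of_ne (by positivity) h0.symm
    set θ := inner ℝ x X / (‖x‖ * c) with hθ
    have hθi : inner ℝ x X = θ * (‖x‖ * c) := (div_mul_cancel₀ _ h0).symm
    have hθ1 : |θ| ≤ 1 := by
      rw [hθ, abs_div, abs_of_pos hpos]; exact (div_le_one hpos).2 habs
    obtain ⟨h1, h2⟩ := abs_le.1 hθ1
    -- With θ playing the role of a cosine, ‖x‖² + 2θ‖x‖c + c² is the mixture of (‖x‖ + c)² and (‖x‖
    -- - c)² with weights (1 ± θ)/2. The resulting bound is affine in X, so centring removes its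
    -- linear part.
    have key := cosh_le_interpolation (s := (1 + θ) / 2) (a := t * ‖x‖ + t * c)
      (b := t * ‖x‖ - t * c) (w := t * ‖x + X‖) (by linarith) (by linarith) (by
        rw [mul_pow, hn, hθi]
        nlinarith [mul_le_mul_of_nonneg_left hX2 (sq_nonneg t)])
    refine key.trans (le_of_eq ?_)
    rw [Real.cosh_add, Real.cosh_sub, div_mul_eq_mul_div, mul_div_assoc]
    ring

/-- One step of a Hilbert-space martingale with increments bounded by `c`. -/
lemma sum_cosh_norm_add_le {Z : Type*} (s : Finset Z) (w : Z → ℝ) (hw : ∀ z ∈ s, 0 ≤ w z)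
    (hw1 : ∑ z ∈ s, w z = 1) (X : Z → E) (hX0 : ∑ z ∈ s, w z • X z = 0) {c : ℝ}
    (hX : ∀ z ∈ s, ‖X z‖ ≤ c) (t : ℝ) (x : E) :
    ∑ z ∈ s, w z * Real.cosh (t * ‖x + X z‖) ≤
      Real.cosh (t * ‖x‖) * Real.exp (t ^ 2 * c ^ 2 / 2) := by
  have h1 : ∑ z ∈ s, w z * Real.cosh (t * ‖x + X z‖) ≤
      ∑ z ∈ s, (w z * (Real.cosh (t * ‖x‖) * Real.cosh (t * c))
        + Real.sinh (t * ‖x‖) * Real.sinh (t * c) / (‖x‖ * c) * inner ℝ x (w z • X z)) := by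
    refine Finset.sum_le_sum fun z hz => ?_
    refine (mul_le_mul_of_nonneg_left (cosh_norm_add_le t x (X z) (hX z hz)) (hw z hz)).trans
      (le_of_eq ?_)
    rw [inner_smul_right]; ring
  refine h1.trans ?_
  rw [Finset.sum_add_distrib, ← Finset.sum_mul, hw1, one_mul, ← Finset.mul_sum, ← inner_sum, hX0,
    inner_zero_right, mul_zero, add_zero]
  have := Real.cosh_le_exp_half_sq (t * c)
  rw [mul_pow] at this
  exact mul_le_mul_of_nonneg_left this (Real.cosh_pos _).le

end Cosh

-- One step of the exponential supermartingale

section Step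

variable {Ω Z : Type*} {F : MeasurableSpace Ω} [mΩ : MeasurableSpace Ω] {μ : Measure Ω} [MeasurableSpace Z]
  [MeasurableSingletonClass Z]

/-- Integration over a fresh sample with finitely many values, with the past frozen. -/
lemma lintegral_fresh_sample (hF : F ≤ mΩ) (s : Finset Z) (w : Z → ℝ)
    {ζ : Ω → Z} (hζ : Measurable ζ) (hmem : ∀ ω, ζ ω ∈ s)
    (hlaw : ∀ z ∈ s, μ (ζ ⁻¹' {z}) = ENNReal.ofReal (w z))
    (hind : Indep F (MeasurableSpace.comap ζ inferInstance) μ) (g : Z → Ω → ENNReal)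
    (hg : ∀ z ∈ s, Measurable[F] (g z)) :
    ∫⁻ ω, g (ζ ω) ω ∂μ = ∫⁻ ω, ∑ z ∈ s, ENNReal.ofReal (w z) * g z ω ∂μ := by
  classical
  have hI : ∀ z, Measurable[MeasurableSpace.comap ζ inferInstance]
      ((ζ ⁻¹' {z}).indicator (1 : Ω → ENNReal)) := fun z =>
    (measurable_one.indicator (measurableSet_singleton z)).comp (comap_measurable ζ)
  have h1 : ∀ ω, g (ζ ω) ω = ∑ z ∈ s, g z ω * (ζ ⁻¹' {z}).indicator 1 ω := by
    intro ω
    rw [Finset.sum_eq_single (ζ ω)]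
    · simp
    · intro z _ hz
      simp [Set.indicator, hz.symm]
    · exact fun h => absurd (hmem ω) h
  simp_rw [h1]
  rw [lintegral_finsetSum', lintegral_finsetSum']
  · refine Finset.sum_congr rfl fun z hz => ?_
    rw [lintegral_mul_eq_lintegral_mul_lintegral_of_independent_measurableSpace hF
      hζ.comap_le hind (hg z hz) (hI z),
      lintegral_indicator_one (hζ (measurableSet_singleton z)), hlaw z hz,
      lintegral_const_mul _ ((hg z hz).mono hF le_rfl), mul_comm]
  · exact fun z hz => (((hg z hz).mono hF le_rfl).const_mul _).aemeasurable
  · exact fun z hz => (((hg z hz).mono hF le_rfl).mul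
      (measurable_one.indicator (hζ (measurableSet_singleton z)))).aemeasurable

variable {E : Type*} [NormedAddCommGroup E] [InnerProductSpace ℝ E] [MeasurableSpace E]
  [BorelSpace E] [SecondCountableTopology E]

/-- The exponential supermartingale of a Hilbert-space martingale. -/
def expMart (t : ℝ) (M : E) (V : ℝ) : ENNReal :=
  ENNReal.ofReal (Real.cosh (t * ‖M‖) * Real.exp (-(t ^ 2 * V / 2)))

omit [InnerProductSpace ℝ E] [SecondCountableTopology E] in
lemma measurable_expMart {Ω' : Type*} [MeasurableSpace Ω'] (t : ℝ) {M : Ω' → E} {V : Ω' → ℝ}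
    (hM : Measurable M) (hV : Measurable V) : Measurable fun ω => expMart t (M ω) (V ω) := by
  unfold expMart
  fun_prop

/-- Once the past is frozen this is `sum_cosh_norm_add_le`, and exp(-t²c²/2) cancels the growth. The
bound c may be random as long as the past determines it, which is what permits self-normalization.
-/
lemma lintegral_expMart_step (hF : F ≤ mΩ) (s : Finset Z) (w : Z → ℝ)
    (hw : ∀ z ∈ s, 0 ≤ w z) (hw1 : ∑ z ∈ s, w z = 1)
    {ζ : Ω → Z} (hζ : Measurable ζ) (hmem : ∀ ω, ζ ω ∈ s)
    (hlaw : ∀ z ∈ s, μ (ζ ⁻¹' {z}) = ENNReal.ofReal (w z))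
    (hind : Indep F (MeasurableSpace.comap ζ inferInstance) μ)
    {M : Ω → E} {V c : Ω → ℝ} (hM : Measurable[F] M) (hV : Measurable[F] V)
    (hc : Measurable[F] c) {X : Z → Ω → E} (hX : ∀ z ∈ s, Measurable[F] (X z))
    (hX0 : ∀ ω, ∑ z ∈ s, w z • X z ω = 0) (hXc : ∀ z ∈ s, ∀ ω, ‖X z ω‖ ≤ c ω) (t : ℝ) :
    ∫⁻ ω, expMart t (M ω + X (ζ ω) ω) (V ω + c ω ^ 2) ∂μ ≤ ∫⁻ ω, expMart t (M ω) (V ω) ∂μ := by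
  rw [lintegral_fresh_sample hF s w hζ hmem hlaw hind
    (fun z ω => expMart t (M ω + X z ω) (V ω + c ω ^ 2)) (fun z hz =>
      @measurable_expMart E _ _ _ Ω F t _ _ (Measurable.add hM (hX z hz))
        (Measurable.add hV (Measurable.pow_const hc 2)))]
  refine lintegral_mono fun ω => ?_
  simp only [expMart]
  rw [Finset.sum_congr rfl fun z hz => (ENNReal.ofReal_mul (hw z hz)).symm,
    ← ENNReal.ofReal_sum_of_nonneg (fun z hz => mul_nonneg (hw z hz)
      (mul_nonneg (Real.cosh_pos _).le (Real.exp_pos _).le))]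
  refine ENNReal.ofReal_le_ofReal ?_
  have key := sum_cosh_norm_add_le s w hw hw1 (fun z => X z ω) (hX0 ω)
    (fun z hz => hXc z hz ω) t (M ω)
  simp_rw [← mul_assoc, ← Finset.sum_mul]
  refine (mul_le_mul_of_nonneg_right key (Real.exp_pos _).le).trans (le_of_eq ?_)
  rw [mul_assoc, ← Real.exp_add]
  congr 2
  ring

end Step

-- Filtration generated by the draws

section History

variable {Ω Z : Type*} {d P : ℕ} [MeasurableSpace Z]

/-- The σ-algebra generated by a set of elementary draws. -/
@[reducible] def history (U : Ω → Draws d P Z) (A : Set (Source P)) : MeasurableSpace Ω :=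
  ⨆ a ∈ A, Source.sigma U a

/-- All perturbations and selections, and the samples of the iterations before `j`. -/
def past (j : ℕ) : Set (Source P) :=
  {a | match a with
    | .noise _ => True
    | .select _ => True
    | .sample _ i _ => i < j}

/-- The draws in `past j` and the samples of iteration `j` labelled by `B`. -/
def pastWith (j : ℕ) (B : Finset (Fin P × ℕ)) : Set (Source P) :=
  past j ∪ {a | ∃ q ∈ B, a = .sample q.1 j q.2}

variable (U : Ω → Draws d P Z)

lemma history_mono {A B : Set (Source P)} (h : A ⊆ B) : history U A ≤ history U B :=
  biSup_mono h

lemma sigma_le_history {A : Set (Source P)} {a : Source P} (ha : a ∈ A) :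
    Source.sigma U a ≤ history U A :=
  le_biSup (Source.sigma U) ha

lemma past_mono {i j : ℕ} (h : i ≤ j) : (past i : Set (Source P)) ⊆ past j := by
  rintro (_ | _ | _) ha
  · trivial
  · trivial
  · exact lt_of_lt_of_le ha h

lemma past_subset_pastWith (j : ℕ) (B : Finset (Fin P × ℕ)) : past j ⊆ pastWith j B :=
  Set.subset_union_left

lemma pastWith_subset_past {i j : ℕ} (h : i < j) (B : Finset (Fin P × ℕ)) :
    pastWith i B ⊆ past j := by
  rintro a (ha | ⟨q, _, rfl⟩)
  · exact past_mono h.le ha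
  · exact h

/-- The samples of one iteration are revealed one at a time; those not yet revealed stay fresh. -/
lemma sample_notMem_pastWith {j : ℕ} {B : Finset (Fin P × ℕ)} {q : Fin P × ℕ} (hq : q ∉ B) :
    Source.sample q.1 j q.2 ∉ (pastWith j B : Set (Source P)) := by
  rintro (ha | ⟨q', hq', h⟩)
  · exact lt_irrefl j ha
  · injection h with h1 _ h2
    exact hq (by rwa [Prod.ext h1 h2])

lemma measurable_noise_history {A : Set (Source P)} {i : ℕ} (h : Source.noise i ∈ A) :
    Measurable[history U A] fun ω => (U ω).ξ i :=
  (comap_measurable _).mono (sigma_le_history U h) le_rfl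

lemma measurable_select_history {A : Set (Source P)} {n : ℕ} (h : Source.select n ∈ A) :
    Measurable[history U A] fun ω => (U ω).worker n :=
  (comap_measurable _).mono (sigma_le_history U h) le_rfl

lemma measurable_sample_history {A : Set (Source P)} {p : Fin P} {i l : ℕ}
    (h : Source.sample p i l ∈ A) : Measurable[history U A] fun ω => (U ω).z p i l :=
  (comap_measurable _).mono (sigma_le_history U h) le_rfl

variable {U} [mΩ : MeasurableSpace Ω] {μ : Measure Ω} {pb : Problem d P Z} {r : ℝ}

lemma IsSampling.sigma_le (hU : IsSampling μ pb r U) (a : Source P) :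
    Source.sigma U a ≤ mΩ := by
  rcases a with i | n | ⟨p, i, l⟩
  · exact (hU.measurable_ξ i).comap_le
  · exact (hU.measurable_worker n).comap_le
  · exact (hU.measurable_z p i l).comap_le

lemma IsSampling.history_le (hU : IsSampling μ pb r U) (A : Set (Source P)) :
    history U A ≤ mΩ :=
  iSup₂_le fun a _ => hU.sigma_le a

/-- Any family of other draws is independent of a given draw. Hence the past may contain all
perturbations and selections, even future ones: after these are revealed, the samples are the only
randomness left. -/
lemma IsSampling.indep_history (hU : IsSampling μ pb r U) {A : Set (Source P)} {a : Source P}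
    (ha : a ∉ A) : Indep (history U A) (Source.sigma U a) μ := by
  have := indep_iSup_of_disjoint hU.sigma_le hU.indep (S := A) (T := {a})
    (Set.disjoint_singleton_right.2 ha)
  simpa using this

end History

-- Distributions with finite support

section Finite

variable {Z : Type*}

/-- The finite support of a distribution. -/
def finSupport (D : PMF Z) (h : D.support.Finite) : Finset Z := h.toFinset

lemma sum_finSupport (D : PMF Z) (h : D.support.Finite) :
    ∑ z ∈ finSupport D h, (D z).toReal = 1 := by
  rw [← ENNReal.toReal_sum fun z _ => D.apply_ne_top z]
  have : ∑ z ∈ finSupport D h, D z = 1 := by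
    rw [← D.tsum_coe]
    refine (tsum_eq_sum fun z hz => ?_).symm
    by_contra h0
    exact hz (by simpa [finSupport] using h0)
  rw [this, ENNReal.toReal_one]

/-- A function of a sample with finitely many values is measurable if all its sections are. -/
lemma measurable_eval_sample {Ω E : Type*} [MeasurableSpace Ω] [MeasurableSpace Z]
    [MeasurableSingletonClass Z] [MeasurableSpace E] (s : Finset Z) {ζ : Ω → Z}
    (hζ : Measurable ζ) (hmem : ∀ ω, ζ ω ∈ s) {X : Z → Ω → E} (hX : ∀ z ∈ s, Measurable (X z)) :
    Measurable fun ω => X (ζ ω) ω := by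
  intro B hB
  have : (fun ω => X (ζ ω) ω) ⁻¹' B = ⋃ z ∈ s, (ζ ⁻¹' {z} ∩ X z ⁻¹' B) := by
    ext ω
    simp only [Set.mem_preimage, Set.mem_iUnion, Set.mem_inter_iff, Set.mem_singleton_iff]
    constructor
    · exact fun h => ⟨ζ ω, hmem ω, rfl, h⟩
    · rintro ⟨z, _, rfl, h⟩
      exact h
  rw [this]
  exact s.measurableSet_biUnion fun z hz => (hζ (measurableSet_singleton z)).inter (hX z hz hB)

end Finite

-- Iterating the supermartingale step

section Concentration

variable {Ω Z : Type*} {d P : ℕ} [MeasurableSpace Z] [DiscreteMeasurableSpace Z]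
  {U : Ω → Draws d P Z} [mΩ : MeasurableSpace Ω] {μ : Measure Ω} [IsProbabilityMeasure μ]
  {pb : Problem d P Z} {r : ℝ}
  {E : Type*} [NormedAddCommGroup E] [InnerProductSpace ℝ E] [MeasurableSpace E]
  [BorelSpace E] [SecondCountableTopology E]

/-- The exponential supermartingale inequality for sums of increments, each of which is centred
with respect to its own fresh sample and depends on the past otherwise. -/
theorem lintegral_expMart_le_one (hU : IsSampling μ pb r U) (hoff : pb.Offline)
    (hmem : ∀ ω p i l, (U ω).z p i l ∈ (pb.D p).support) (m : ℕ → ℕ)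
    (X : Fin P → ℕ → Z → Ω → E) (c : Fin P → ℕ → Ω → ℝ)
    (hX : ∀ p j, ∀ z ∈ (pb.D p).support, Measurable[history U (past j)] (X p j z))
    (hc : ∀ p j, Measurable[history U (past j)] (c p j))
    (hX0 : ∀ p j ω, ∑ z ∈ finSupport (pb.D p) (hoff p), (pb.D p z).toReal • X p j z ω = 0)
    (hXc : ∀ p j, ∀ z ∈ (pb.D p).support, ∀ ω, ‖X p j z ω‖ ≤ c p j ω) (t : ℝ) (A : Finset ℕ) :
    ∫⁻ ω, expMart t
      (∑ j ∈ A, ∑ q ∈ Finset.univ ×ˢ Finset.range (m j), X q.1 j ((U ω).z q.1 j q.2) ω)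
      (∑ j ∈ A, ∑ q ∈ (Finset.univ : Finset (Fin P)) ×ˢ Finset.range (m j), c q.1 j ω ^ 2) ∂μ
      ≤ 1 := by
  have hmemF : ∀ p i l ω, (U ω).z p i l ∈ finSupport (pb.D p) (hoff p) := fun p i l ω => by
    simpa [finSupport] using hmem ω p i l
  have hsupp : ∀ p z, z ∈ finSupport (pb.D p) (hoff p) → z ∈ (pb.D p).support := fun p z hz => by
    simpa [finSupport] using hz
  have hXm : ∀ j (B : Finset (Fin P × ℕ)), ∀ q ∈ B, Measurable[history U (pastWith j B)]
      fun ω => X q.1 j ((U ω).z q.1 j q.2) ω := fun j B q hq =>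
    @measurable_eval_sample _ Ω E (history U (pastWith j B)) _ _ _ _ _
      (measurable_sample_history U (Or.inr ⟨q, hq, rfl⟩)) (hmemF q.1 j q.2) _
      fun z hz => (hX q.1 j z (hsupp _ _ hz)).mono
        (history_mono U (past_subset_pastWith j B)) le_rfl
  have hcm : ∀ j (B : Finset (Fin P × ℕ)) p, Measurable[history U (pastWith j B)] (c p j) :=
    fun j B p => (hc p j).mono (history_mono U (past_subset_pastWith j B)) le_rfl
  -- Adding the latest iteration last keeps everything accumulated earlier measurable with respect
  -- to `past j`.
  induction A using Finset.induction_on_max with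
  | empty => simp [expMart]
  | insert j A hj ih =>
    refine le_trans ?_ ih
    have hjA : j ∉ A := fun h => lt_irrefl j (hj j h)
    have hMA : Measurable[history U (past j)] fun ω => ∑ i ∈ A,
        ∑ q ∈ Finset.univ ×ˢ Finset.range (m i), X q.1 i ((U ω).z q.1 i q.2) ω :=
      Finset.measurable_fun_sum _ fun i hi => Finset.measurable_fun_sum _ fun q hq =>
        (hXm i _ q hq).mono (history_mono U (pastWith_subset_past (hj i hi) _)) le_rfl
    have hVA : Measurable[history U (past j)] fun ω => ∑ i ∈ A,
        ∑ q ∈ (Finset.univ : Finset (Fin P)) ×ˢ Finset.range (m i), c q.1 i ω ^ 2 :=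
      Finset.measurable_fun_sum _ fun i hi => Finset.measurable_fun_sum _ fun q _ =>
        Measurable.pow_const ((hc q.1 i).mono (history_mono U (past_mono (hj i hi).le)) le_rfl) 2
    simp only [Finset.sum_insert hjA]
    -- Within an iteration the order of the samples is immaterial: each increment depends on `past
    -- j` and its own sample only. An arbitrary finite set of labels therefore supports the inner
    -- induction.
    generalize (Finset.univ : Finset (Fin P)) ×ˢ Finset.range (m j) = B
    induction B using Finset.induction_on with
    | empty => simp
    | insert q B hq ihB =>
      refine le_trans ?_ ihB
      have hp := history_mono U (past_subset_pastWith j B)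
      have hstep := lintegral_expMart_step (μ := μ) (hU.history_le (pastWith j B))
        (finSupport (pb.D q.1) (hoff q.1)) (fun z => (pb.D q.1 z).toReal)
        (fun _ _ => ENNReal.toReal_nonneg) (sum_finSupport _ _)
        (hU.measurable_z q.1 j q.2) (hmemF q.1 j q.2)
        (fun z _ => by
          rw [← Measure.map_apply (hU.measurable_z q.1 j q.2) (measurableSet_singleton z),
            hU.law_z, PMF.toMeasure_apply_singleton _ _ (measurableSet_singleton z),
            ENNReal.ofReal_toReal (PMF.apply_ne_top _ z)])
        (hU.indep_history (sample_notMem_pastWith hq))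
        (M := fun ω => ∑ q ∈ B, X q.1 j ((U ω).z q.1 j q.2) ω + ∑ i ∈ A,
          ∑ q ∈ Finset.univ ×ˢ Finset.range (m i), X q.1 i ((U ω).z q.1 i q.2) ω)
        (V := fun ω => ∑ q ∈ B, c q.1 j ω ^ 2 + ∑ i ∈ A,
          ∑ q ∈ (Finset.univ : Finset (Fin P)) ×ˢ Finset.range (m i), c q.1 i ω ^ 2)
        (c := c q.1 j) (X := X q.1 j)
        (Measurable.add (Finset.measurable_fun_sum _ fun q hq => hXm j B q hq) (hMA.mono hp le_rfl))
        (Measurable.add (Finset.measurable_fun_sum _ fun q _ => Measurable.pow_const (hcm j B q.1) 2)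
          (hVA.mono hp le_rfl))
        (hcm j B q.1)
        (fun z hz => (hX q.1 j z (hsupp _ _ hz)).mono hp le_rfl)
        (hX0 q.1 j) (fun z hz => hXc q.1 j z (hsupp _ _ hz)) t
      refine le_trans (le_of_eq ?_) hstep
      refine lintegral_congr fun ω => ?_
      rw [Finset.sum_insert hq, Finset.sum_insert hq]
      congr 1 <;> abel

end Concentration

-- Smoothness and heterogeneity of the objectives

section Objective

variable {Z : Type*} {d P : ℕ} {pb : Problem d P Z} {L ζ G : ℝ}

lemma GradLipschitz.continuous {g : Vec d → ℝ} (h : GradLipschitz L g) :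
    Continuous (gradient g) := by
  have : LipschitzWith L.toNNReal (gradient g) := LipschitzWith.of_dist_le_mul fun x y => by
    rw [dist_eq_norm, dist_eq_norm]
    exact (h.2 x y).trans (by gcongr; exact Real.le_coe_toNNReal L)
  exact this.continuous

/-- First-order Taylor bound for a function with Lipschitz gradient. -/
lemma GradLipschitz.le_taylor {g : Vec d → ℝ} (hL : 0 ≤ L) (h : GradLipschitz L g)
    (x y : Vec d) : g y ≤ g x + inner ℝ (gradient g x) (y - x) + L * ‖y - x‖ ^ 2 := by
  -- The mean value inequality on the segment gives L in place of the sharp L/2; the bound ηL ≤ 1/8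
  -- makes the loss harmless.
  have key := (convex_segment x y).norm_image_sub_le_of_norm_hasFDerivWithin_le' (f := g)
    (f' := fun z => fderiv ℝ g z) (φ := fderiv ℝ g x) (C := L * ‖y - x‖)
    (fun z _ => (h.1 z).hasFDerivAt.hasFDerivWithinAt) (fun z hz => ?_)
    (left_mem_segment ℝ x y) (right_mem_segment ℝ x y)
  · have h2 : fderiv ℝ g x (y - x) = inner ℝ (gradient g x) (y - x) := by
      rw [gradient, InnerProductSpace.toDual_symm_apply]
    rw [h2] at key
    have := (le_abs_self _).trans key
    linarith [sq ‖y - x‖, mul_assoc L ‖y - x‖ ‖y - x‖]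
  · have h1 : ‖fderiv ℝ g z - fderiv ℝ g x‖ = ‖gradient g z - gradient g x‖ := by
      rw [gradient, gradient, ← map_sub, LinearIsometryEquiv.norm_map]
    rw [h1]
    refine (h.2 z x).trans (mul_le_mul_of_nonneg_left ?_ hL)
    exact norm_sub_le_of_mem_segment hz

lemma hasGradientAt_of_grad {g : Vec d → ℝ} (h : Differentiable ℝ g) (x : Vec d) :
    HasGradientAt g (gradient g x) x := (h x).hasGradientAt

lemma hasGradientAt_sum_const_mul {ι : Type*} (s : Finset ι) (w : ι → ℝ) (g : ι → Vec d → ℝ)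
    (g' : ι → Vec d) (x : Vec d) (h : ∀ z ∈ s, HasGradientAt (g z) (g' z) x) :
    HasGradientAt (fun y => ∑ z ∈ s, w z * g z y) (∑ z ∈ s, w z • g' z) x := by
  rw [hasGradientAt_iff_hasFDerivAt, map_sum]
  refine HasFDerivAt.fun_sum fun z hz => ?_
  rw [map_smul]
  exact (h z hz).hasFDerivAt.const_mul (w z)

lemma localObj_eq_sum (hoff : pb.Offline) (p : Fin P) :
    pb.localObj p = fun x => ∑ z ∈ finSupport (pb.D p) (hoff p), (pb.D p z).toReal * pb.loss x z := by
  funext x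
  refine tsum_eq_sum fun z hz => ?_
  have : pb.D p z = 0 := by
    by_contra h0
    exact hz (by simpa [finSupport] using h0)
  rw [this, ENNReal.toReal_zero, zero_mul]

lemma mem_support_of_mem_finSupport {D : PMF Z} {h : D.support.Finite} {z : Z}
    (hz : z ∈ finSupport D h) : z ∈ D.support := by
  simpa [finSupport] using hz

lemma hasGradientAt_localObj (hoff : pb.Offline) (hlip : pb.LossGradLipschitz L) (p : Fin P)
    (x : Vec d) : HasGradientAt (pb.localObj p)
      (∑ z ∈ finSupport (pb.D p) (hoff p), (pb.D p z).toReal • pb.lossGrad x z) x := by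
  rw [localObj_eq_sum hoff p]
  exact hasGradientAt_sum_const_mul _ _ (fun z y => pb.loss y z) _ x fun z hz =>
    hasGradientAt_of_grad (hlip p z (mem_support_of_mem_finSupport hz)).1 x

lemma gradient_localObj (hoff : pb.Offline) (hlip : pb.LossGradLipschitz L) (p : Fin P)
    (x : Vec d) : gradient (pb.localObj p) x =
      ∑ z ∈ finSupport (pb.D p) (hoff p), (pb.D p z).toReal • pb.lossGrad x z :=
  (hasGradientAt_localObj hoff hlip p x).gradient

lemma hasGradientAt_obj (hoff : pb.Offline) (hlip : pb.LossGradLipschitz L) (x : Vec d) :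
    HasGradientAt pb.obj (average fun p => gradient (pb.localObj p) x) x := by
  have h1 : pb.obj = fun y => ∑ p, (P : ℝ)⁻¹ * pb.localObj p y := by
    funext y
    rw [Problem.obj, Finset.mul_sum]
  rw [h1, average, Finset.smul_sum]
  refine hasGradientAt_sum_const_mul _ _ _ _ x fun p _ => ?_
  rw [gradient_localObj hoff hlip]
  exact hasGradientAt_localObj hoff hlip p x

lemma gradient_obj (hoff : pb.Offline) (hlip : pb.LossGradLipschitz L) (x : Vec d) :
    gradient pb.obj x = average fun p => gradient (pb.localObj p) x :=
  (hasGradientAt_obj hoff hlip x).gradient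

/-- A weighted mean of vectors of norm at most `C` has norm at most `C`. -/
lemma norm_sum_smul_le {ι E : Type*} [NormedAddCommGroup E] [NormedSpace ℝ E] (s : Finset ι)
    (w : ι → ℝ) (hw : ∀ z ∈ s, 0 ≤ w z) (hw1 : ∑ z ∈ s, w z = 1) (X : ι → E) {C : ℝ}
    (hX : ∀ z ∈ s, ‖X z‖ ≤ C) : ‖∑ z ∈ s, w z • X z‖ ≤ C := by
  calc ‖∑ z ∈ s, w z • X z‖ ≤ ∑ z ∈ s, w z * C := norm_sum_le_of_le _ fun z hz => by
        rw [norm_smul, Real.norm_of_nonneg (hw z hz)]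
        exact mul_le_mul_of_nonneg_left (hX z hz) (hw z hz)
    _ = C := by rw [← Finset.sum_mul, hw1, one_mul]

lemma norm_average_le (hP : 0 < P) (X : Fin P → Vec d) {C : ℝ} (hX : ∀ p, ‖X p‖ ≤ C) :
    ‖average X‖ ≤ C := by
  rw [average, Finset.smul_sum]
  refine norm_sum_smul_le _ _ (fun _ _ => by positivity) ?_ X fun p _ => hX p
  rw [Finset.sum_const, Finset.card_univ, Fintype.card_fin, nsmul_eq_mul,
    mul_inv_cancel₀ (by positivity)]

lemma average_sub (X Y : Fin P → Vec d) :
    average (fun p => X p - Y p) = average X - average Y := by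
  simp only [average, Finset.sum_sub_distrib, smul_sub]

lemma average_const (hP : 0 < P) (v : Vec d) : average (fun _ : Fin P => v) = v := by
  rw [average, Finset.sum_const, Finset.card_univ, Fintype.card_fin, ← Nat.cast_smul_eq_nsmul ℝ,
    smul_smul, inv_mul_cancel₀ (by positivity), one_smul]

lemma gradient_localObj_sub (hoff : pb.Offline) (hlip : pb.LossGradLipschitz L) (p : Fin P)
    (x y : Vec d) : gradient (pb.localObj p) x - gradient (pb.localObj p) y =
      ∑ z ∈ finSupport (pb.D p) (hoff p),
        (pb.D p z).toReal • (pb.lossGrad x z - pb.lossGrad y z) := by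
  simp_rw [gradient_localObj hoff hlip, smul_sub, Finset.sum_sub_distrib]

lemma gradLipschitz_localObj (hoff : pb.Offline) (hlip : pb.LossGradLipschitz L) (p : Fin P) :
    GradLipschitz L (pb.localObj p) := by
  refine ⟨fun x => (hasGradientAt_localObj hoff hlip p x).differentiableAt, fun x y => ?_⟩
  rw [gradient_localObj_sub hoff hlip]
  exact norm_sum_smul_le _ _ (fun _ _ => ENNReal.toReal_nonneg) (sum_finSupport _ _) _
    fun z hz => (hlip p z (mem_support_of_mem_finSupport hz)).2 x y

lemma gradLipschitz_obj (hP : 0 < P) (hoff : pb.Offline) (hlip : pb.LossGradLipschitz L) :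
    GradLipschitz L pb.obj := by
  refine ⟨fun x => (hasGradientAt_obj hoff hlip x).differentiableAt, fun x y => ?_⟩
  rw [gradient_obj hoff hlip, gradient_obj hoff hlip, ← average_sub]
  exact norm_average_le hP _ fun p => (gradLipschitz_localObj hoff hlip p).2 x y

/-- Second-order heterogeneity makes the deviation of a local gradient `ζ`-Lipschitz. -/
lemma norm_heterogeneity_le (hP : 0 < P) (hoff : pb.Offline) (hlip : pb.LossGradLipschitz L)
    (hhet : pb.Heterogeneous ζ) (p : Fin P) (x y : Vec d) :
    ‖(gradient pb.obj x - gradient (pb.localObj p) x)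
      - (gradient pb.obj y - gradient (pb.localObj p) y)‖ ≤ ζ * ‖x - y‖ := by
  have h1 : ∀ p', ‖(gradient (pb.localObj p') x - gradient (pb.localObj p) x)
      - (gradient (pb.localObj p') y - gradient (pb.localObj p) y)‖ ≤ ζ * ‖x - y‖ := fun p' =>
    convex_univ.norm_image_sub_le_of_norm_fderiv_le (𝕜 := ℝ)
      (f := fun x => gradient (pb.localObj p') x - gradient (pb.localObj p) x)
      (fun z _ => ((hhet.1 p').2 z).fun_sub ((hhet.1 p).2 z))
      (fun z _ => by
        rw [fderiv_fun_sub ((hhet.1 p').2 z) ((hhet.1 p).2 z)]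
        exact hhet.2 p' p z) (Set.mem_univ y) (Set.mem_univ x)
  have h2 := norm_average_le hP _ h1
  rwa [average_sub, average_sub, average_sub, average_const hP, average_const hP,
    ← gradient_obj hoff hlip, ← gradient_obj hoff hlip] at h2

lemma continuous_lossGrad (hlip : pb.LossGradLipschitz L) {p : Fin P} {z : Z}
    (hz : z ∈ (pb.D p).support) : Continuous fun x => pb.lossGrad x z :=
  (hlip p z hz).continuous

/-- The deviation of a stochastic gradient difference from its mean. -/
def Problem.noiseDiff (pb : Problem d P Z) (p : Fin P) (x y : Vec d) (z : Z) : Vec d :=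
  (gradient (pb.localObj p) x - gradient (pb.localObj p) y) - (pb.lossGrad x z - pb.lossGrad y z)

lemma sum_noiseDiff (hoff : pb.Offline) (hlip : pb.LossGradLipschitz L) (p : Fin P)
    (x y : Vec d) :
    ∑ z ∈ finSupport (pb.D p) (hoff p), (pb.D p z).toReal • pb.noiseDiff p x y z = 0 := by
  simp_rw [Problem.noiseDiff, smul_sub _ (_ - _) (_ - _), Finset.sum_sub_distrib,
    ← Finset.sum_smul, sum_finSupport, one_smul]
  rw [← gradient_localObj_sub hoff hlip, sub_self]

/-- The first bound ties the noise to the displacement. The second bounds the quadratic variation by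
a constant, which keeps the grid of exponential parameters finite. -/
lemma norm_noiseDiff_le (hoff : pb.Offline) (hlip : pb.LossGradLipschitz L)
    (hG : pb.LossGradBounded G) (p : Fin P) (x y : Vec d) {z : Z} (hz : z ∈ (pb.D p).support) :
    ‖pb.noiseDiff p x y z‖ ≤ min (2 * L * ‖x - y‖) (4 * G) := by
  refine le_min ?_ ?_
  · have h1 := (gradLipschitz_localObj hoff hlip p).2 x y
    have h2 := (hlip p z hz).2 x y
    refine (norm_sub_le _ _).trans ?_
    rw [Problem.lossGrad, Problem.lossGrad]
    linarith
  · have h1 : ∀ x, ‖gradient (pb.localObj p) x‖ ≤ G := fun x => by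
      rw [gradient_localObj hoff hlip]
      exact norm_sum_smul_le _ _ (fun _ _ => ENNReal.toReal_nonneg) (sum_finSupport _ _) _
        fun z hz => hG p z (mem_support_of_mem_finSupport hz) x
    have h2 := hG p z hz
    rw [Problem.noiseDiff]
    refine (norm_sub_le _ _).trans ?_
    linarith [norm_sub_le (gradient (pb.localObj p) x) (gradient (pb.localObj p) y),
      norm_sub_le (pb.lossGrad x z) (pb.lossGrad y z), h1 x, h1 y, h2 x, h2 y]

lemma gradBound_nonneg (hP : 0 < P) (hG : pb.LossGradBounded G) : 0 ≤ G := by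
  obtain ⟨z, hz⟩ := (pb.D ⟨0, hP⟩).support_nonempty
  exact (norm_nonneg _).trans (hG _ z hz 0)

end Objective

-- Adaptedness of the algorithm

section Measurability

variable {Ω Z : Type*} {d P : ℕ} [MeasurableSpace Z] [DiscreteMeasurableSpace Z]
  {U : Ω → Draws d P Z} {pb : Problem d P Z} {L : ℝ}

omit [MeasurableSpace Z] [DiscreteMeasurableSpace Z] in
lemma measurable_gradient_localObj (hoff : pb.Offline) (hlip : pb.LossGradLipschitz L)
    (p : Fin P) : Measurable (gradient (pb.localObj p)) :=
  (gradLipschitz_localObj hoff hlip p).continuous.measurable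

lemma measurable_average {Ω' : Type*} [MeasurableSpace Ω'] {v : Ω' → Fin P → Vec d}
    (hv : ∀ p, Measurable fun ω => v ω p) : Measurable fun ω => average (v ω) := by
  have h : Measurable fun ω => ∑ p, v ω p := Finset.measurable_fun_sum _ fun p _ => hv p
  exact h.const_smul (P : ℝ)⁻¹

lemma measurable_batchGrad {Ω' : Type*} [MeasurableSpace Ω'] (hoff : pb.Offline)
    (hlip : pb.LossGradLipschitz L) (p : Fin P) (m : ℕ) {zs : Ω' → ℕ → Z}
    (hzs : ∀ l, Measurable fun ω => zs ω l) (hmem : ∀ ω l, zs ω l ∈ (pb.D p).support)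
    {x : Ω' → Vec d} (hx : Measurable x) :
    Measurable fun ω => pb.batchGrad m (zs ω) (x ω) := by
  unfold Problem.batchGrad
  suffices h : Measurable fun ω => ∑ l ∈ Finset.range m, pb.lossGrad (x ω) (zs ω l) from
    h.const_smul (m : ℝ)⁻¹
  refine Finset.measurable_fun_sum _ fun l _ => ?_
  exact measurable_eval_sample (finSupport (pb.D p) (hoff p)) (hzs l)
    (fun ω => by simpa [finSupport] using hmem ω l) (X := fun z ω => pb.lossGrad (x ω) z)
    fun z hz => (continuous_lossGrad hlip (mem_support_of_mem_finSupport hz)).measurable.comp hx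

lemma measurable_perturbedStep {Ω' : Type*} [MeasurableSpace Ω'] (η : ℝ) {x v ξ : Ω' → Vec d}
    (hx : Measurable x) (hv : Measurable v) (hξ : Measurable ξ) :
    Measurable fun ω => (x ω - η • v ω) + η • ξ ω := by
  fun_prop

lemma measurable_sub_add {Ω' : Type*} [MeasurableSpace Ω'] {x y v : Ω' → Vec d}
    (hx : Measurable x) (hy : Measurable y) (hv : Measurable v) :
    Measurable fun ω => x ω - y ω + v ω := by
  fun_prop

/-- The state at iteration `i` is determined by the samples up to iteration `i`, the points alone
by those before. -/
lemma measurable_run (hoff : pb.Offline) (hlip : pb.LossGradLipschitz L)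
    (hmem : ∀ ω p i l, (U ω).z p i l ∈ (pb.D p).support) (a : Params d) (i : ℕ) :
    Measurable[history U (past i)] (fun ω => (run pb a (U ω) i).x) ∧
    Measurable[history U (past i)] (fun ω => (run pb a (U ω) i).xRound) ∧
    Measurable[history U (past (i + 1))] (fun ω => (run pb a (U ω) i).v) ∧
    ∀ p, Measurable[history U (past (i + 1))] (fun ω => (run pb a (U ω) i).vWorker p) := by
  have hξ : ∀ j n, Measurable[history U (past j)] fun ω => (U ω).ξ n := fun j n =>
    measurable_noise_history U trivial
  have hgrad : ∀ (F : MeasurableSpace Ω) (x : Ω → Vec d), Measurable x → ∀ p,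
      Measurable fun ω => gradient (pb.localObj p) (x ω) := fun F x hx p =>
    (measurable_gradient_localObj hoff hlip p).comp hx
  have up : ∀ j, history U (past j) ≤ history U (past (j + 1)) := fun j =>
    history_mono U (past_mono j.le_succ)
  induction i with
  | zero =>
    have hx : ∀ j, Measurable[history U (past j)] fun ω => (run pb a (U ω) 0).x := fun j =>
      ((hξ j 0).const_smul a.η).const_add a.x₀
    have hw := hgrad _ _ (hx 1)
    exact ⟨hx 0, hx 0, @measurable_average d P Ω (history U (past 1))
      (fun ω p => gradient (pb.localObj p) (run pb a (U ω) 0).x) hw, hw⟩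
  | succ i ih =>
    obtain ⟨ihx, ihr, ihv, ihw⟩ := ih
    have hx := @measurable_perturbedStep d Ω (history U (past (i + 1))) a.η _ _ _
      (ihx.mono (up i) le_rfl) ihv (hξ (i + 1) (i + 1))
    have ihx' := (ihx.mono (up i) le_rfl).mono (up (i + 1)) le_rfl
    have ihr' := ihr.mono (up i) le_rfl
    have ihr'' := ihr'.mono (up (i + 1)) le_rfl
    have ihv' := ihv.mono (up (i + 1)) le_rfl
    have ihw' := fun p => (ihw p).mono (up (i + 1)) le_rfl
    have hx' := hx.mono (up (i + 1)) le_rfl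
    clear ihx ihr ihv ihw hξ
    have hz : ∀ p l, Measurable[history U (past (i + 1 + 1))] fun ω => (U ω).z p (i + 1) l :=
      fun p l => measurable_sample_history U (Nat.lt_succ_self (i + 1))
    have hb : ∀ p m x, Measurable[history U (past (i + 1 + 1))] x →
        Measurable[history U (past (i + 1 + 1))]
          fun ω => pb.batchGrad m ((U ω).z p (i + 1)) (x ω) := fun p m x hx =>
      @measurable_batchGrad Z d P _ _ pb L Ω (history U (past (i + 1 + 1))) hoff hlip p m _
        (hz p) (fun ω l => hmem ω p (i + 1) l) _ hx
    have hsel : ∀ n, Measurable[history U (past (i + 1 + 1))] fun ω => (U ω).worker n :=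
      fun n => measurable_select_history U trivial
    -- The index of the selected worker is itself random, but it takes finitely many values, so
    -- measurability is checked worker by worker.
    have hsb : ∀ m n x, Measurable[history U (past (i + 1 + 1))] x →
        Measurable[history U (past (i + 1 + 1))]
          fun ω => pb.batchGrad m ((U ω).z ((U ω).worker n) (i + 1)) (x ω) := fun m n x hx =>
      @measurable_eval_sample (Fin P) Ω (Vec d) (history U (past (i + 1 + 1))) _ _ _ Finset.univ _
        (hsel n) (fun _ => Finset.mem_univ _)
        (fun p ω => pb.batchGrad m ((U ω).z p (i + 1)) (x ω)) fun p _ => hb p m x hx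
    simp only [run]
    split_ifs with h1 h2
    · have hw := hgrad _ _ hx'
      exact ⟨hx, hx, @measurable_average d P Ω (history U (past (i + 1 + 1))) _ hw, hw⟩
    · have hw := fun p => @measurable_sub_add d Ω (history U (past (i + 1 + 1))) _ _ _
        (hb p (a.K * a.b) _ hx')
        (hb p (a.K * a.b) _ ihr'') (ihw' p)
      exact ⟨hx, hx, @measurable_average d P Ω (history U (past (i + 1 + 1))) _ hw, hw⟩
    · exact ⟨hx, ihr', @measurable_sub_add d Ω (history U (past (i + 1 + 1))) _ _ _
        (hsb _ _ _ hx') (hsb _ _ _ ihx') ihv', ihw'⟩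

end Measurability

-- Estimation error: sampling noise and drift

section Decomposition

variable {Z : Type*} {d P : ℕ} (pb : Problem d P Z) (a : Params d) (u : Draws d P Z)

/-- The number of samples each worker contributes at iteration `j`. -/
def batchSize (j : ℕ) : ℕ := if a.K ∣ j then a.K * a.b else localBatch a.K a.b (j % a.K)

/-- The weight of a sample of worker `p` in the update of the estimator at iteration `j`. -/
def sampleWeight (p : Fin P) (j : ℕ) : ℝ :=
  if a.K ∣ j then (P : ℝ)⁻¹ * (batchSize a j : ℝ)⁻¹
  else if u.worker (j / a.K) = p then (batchSize a j : ℝ)⁻¹ else 0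

/-- The older of the two points at which gradients are compared at iteration `j`. -/
def anchor (j : ℕ) : Vec d :=
  if a.K ∣ j then (run pb a u (j - 1)).xRound else (run pb a u (j - 1)).x

/-- The contribution to the estimation error of a sample `z` of worker `p` at iteration `j`. -/
def sampleError (p : Fin P) (j : ℕ) (z : Z) : Vec d :=
  sampleWeight a u p j • pb.noiseDiff p (iterate pb a u j) (anchor pb a u j) z

/-- The bound on `sampleError`. -/
def sampleBound (L G : ℝ) (p : Fin P) (j : ℕ) : ℝ :=
  sampleWeight a u p j * min (2 * L * ‖iterate pb a u j - anchor pb a u j‖) (4 * G)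

/-- The contribution of iteration `j` to the estimation error. -/
def stepError (j : ℕ) : Vec d :=
  ∑ q ∈ Finset.univ ×ˢ Finset.range (batchSize a j), sampleError pb a u q.1 j (u.z q.1 j q.2)

/-- The contribution of iteration `j` to the quadratic variation. -/
def stepVar (L G : ℝ) (j : ℕ) : ℝ :=
  ∑ q ∈ (Finset.univ : Finset (Fin P)) ×ˢ Finset.range (batchSize a j),
    sampleBound pb a u L G q.1 j ^ 2

/-- The iterations whose samples enter the estimator at iteration `i`. -/
def active (K T : ℕ) : ℕ → Finset ℕ
  | 0 => ∅
  | i + 1 =>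
    if K * T ∣ i + 1 then ∅
    else if K ∣ i + 1 then insert (i + 1) ((active K T i).filter (K ∣ ·))
    else insert (i + 1) (active K T i)

lemma active_subset (K T i : ℕ) : active K T i ⊆ Finset.Ioc 0 i := by
  induction i with
  | zero => simp [active]
  | succ i ih =>
    have ih' : active K T i ⊆ Finset.Ioc 0 (i + 1) :=
      ih.trans (Finset.Ioc_subset_Ioc_right i.le_succ)
    have hi : i + 1 ∈ Finset.Ioc 0 (i + 1) := by simp
    rw [active]
    split_ifs
    · exact Finset.empty_subset _
    · exact Finset.insert_subset hi ((Finset.filter_subset _ _).trans ih')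
    · exact Finset.insert_subset hi ih'

lemma succ_notMem_active (K T i : ℕ) : i + 1 ∉ active K T i := fun h => by
  have := Finset.mem_Ioc.1 (active_subset K T i h)
  omega

lemma sampleWeight_nonneg (p : Fin P) (j : ℕ) : 0 ≤ sampleWeight a u p j := by
  unfold sampleWeight
  split_ifs <;> positivity

/-- Of the local batch sizes, the variance estimate needs only this lower bound. -/
lemma localBatch_ge {K : ℕ} (hK : 0 < K) (b k : ℕ) : b ≤ localBatch K b k := by
  unfold localBatch
  split_ifs
  · exact Nat.le_mul_of_pos_left b (Nat.ceil_pos.2 (Real.sqrt_pos.2 (by exact_mod_cast hK)))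
  · exact le_rfl

variable {pb a u}

lemma batchSize_ge (hK : 0 < a.K) (j : ℕ) : a.b ≤ batchSize a j := by
  unfold batchSize
  split_ifs
  · exact Nat.le_mul_of_pos_left _ hK
  · exact localBatch_ge hK _ _

lemma sum_noiseDiff_range {p : Fin P} {x y : Vec d} {m : ℕ} (hm : 0 < m) (zs : ℕ → Z) :
    ∑ l ∈ Finset.range m, (m : ℝ)⁻¹ • pb.noiseDiff p x y (zs l) =
      (gradient (pb.localObj p) x - gradient (pb.localObj p) y)
        - (pb.batchGrad m zs x - pb.batchGrad m zs y) := by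
  have : (m : ℝ) ≠ 0 := by positivity
  simp_rw [← Finset.smul_sum, Problem.noiseDiff, Finset.sum_sub_distrib, Problem.batchGrad,
    Finset.sum_const, Finset.card_range, smul_sub, ← Nat.cast_smul_eq_nsmul ℝ, smul_smul,
    inv_mul_cancel₀ this, one_smul]

lemma stepError_of_dvd (hK : 0 < a.K) (hb : 0 < a.b) {j : ℕ} (hj : a.K ∣ j) :
    stepError pb a u j = average fun p =>
      (gradient (pb.localObj p) (iterate pb a u j)
          - gradient (pb.localObj p) (anchor pb a u j))
        - (pb.batchGrad (a.K * a.b) (u.z p j) (iterate pb a u j)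
          - pb.batchGrad (a.K * a.b) (u.z p j) (anchor pb a u j)) := by
  have hm : batchSize a j = a.K * a.b := if_pos hj
  rw [stepError, Finset.sum_product, average, Finset.smul_sum]
  refine Finset.sum_congr rfl fun p _ => ?_
  rw [← sum_noiseDiff_range (by positivity), hm, Finset.smul_sum]
  refine Finset.sum_congr rfl fun l _ => ?_
  rw [sampleError, sampleWeight, if_pos hj, hm, smul_smul]

lemma stepError_of_not_dvd (hK : 0 < a.K) (hb : 0 < a.b) {j : ℕ} (hj : ¬ a.K ∣ j) :
    stepError pb a u j =
      (gradient (pb.localObj (u.worker (j / a.K))) (iterate pb a u j)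
          - gradient (pb.localObj (u.worker (j / a.K))) (anchor pb a u j))
        - (pb.batchGrad (batchSize a j) (u.z (u.worker (j / a.K)) j) (iterate pb a u j)
          - pb.batchGrad (batchSize a j) (u.z (u.worker (j / a.K)) j) (anchor pb a u j)) := by
  rw [stepError, Finset.sum_product, Finset.sum_eq_single (u.worker (j / a.K))]
  · rw [← sum_noiseDiff_range (hb.trans_le (batchSize_ge hK j))]
    refine Finset.sum_congr rfl fun l _ => ?_
    rw [sampleError, sampleWeight, if_neg hj, if_pos rfl]
  · intro p _ hp
    refine Finset.sum_eq_zero fun l _ => ?_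
    rw [sampleError, sampleWeight, if_neg hj, if_neg hp.symm, zero_smul]
  · exact fun h => absurd (Finset.mem_univ _) h

/-- Averaging: at a round start P·m samples of weight 1/(Pm) have squared weights summing to 1/(Pm);
inside a round only the m samples of the selected worker have nonzero weight, giving 1/m. -/
lemma stepVar_eq (hP : 0 < P) (hK : 0 < a.K) (hb : 0 < a.b) (L G : ℝ) (j : ℕ) :
    stepVar pb a u L G j =
      (if a.K ∣ j then (P : ℝ)⁻¹ * (batchSize a j : ℝ)⁻¹ else (batchSize a j : ℝ)⁻¹)
        * (min (2 * L * ‖iterate pb a u j - anchor pb a u j‖) (4 * G)) ^ 2 := by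
  have hm : (batchSize a j : ℝ) ≠ 0 := by
    have := hb.trans_le (batchSize_ge hK j)
    positivity
  have hP' : (P : ℝ) ≠ 0 := by positivity
  simp_rw [stepVar, Finset.sum_product, sampleBound, Finset.sum_const, Finset.card_range,
    nsmul_eq_mul, mul_pow, ← mul_assoc, ← Finset.sum_mul]
  congr 1
  unfold sampleWeight
  split_ifs with hj
  · rw [Finset.sum_const, Finset.card_univ, Fintype.card_fin, nsmul_eq_mul]
    field_simp
  · rw [Finset.sum_eq_single (u.worker (j / a.K))]
    · rw [if_pos rfl]
      field_simp
    · intro p _ hp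
      simp [hp.symm]
    · exact fun h => absurd (Finset.mem_univ _) h

lemma stepVar_nonneg (L G : ℝ) (j : ℕ) : 0 ≤ stepVar pb a u L G j :=
  Finset.sum_nonneg fun _ _ => sq_nonneg _

lemma min_sq_le_left {x y : ℝ} (hx : 0 ≤ x) (hy : 0 ≤ y) : (min x y) ^ 2 ≤ x ^ 2 :=
  pow_le_pow_left₀ (le_min hx hy) (min_le_left _ _) 2

lemma stepVar_le (hP : 0 < P) (hK : 0 < a.K) (hb : 0 < a.b) {L G : ℝ} (hL : 0 ≤ L) (hG : 0 ≤ G)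
    (j : ℕ) : stepVar pb a u L G j ≤ 16 * G ^ 2 := by
  have hm : (1 : ℝ) ≤ batchSize a j := by
    exact_mod_cast (hb.trans_le (batchSize_ge hK j))
  have hP' : (1 : ℝ) ≤ P := by exact_mod_cast hP
  rw [stepVar_eq hP hK hb]
  have h1 : (min (2 * L * ‖iterate pb a u j - anchor pb a u j‖) (4 * G)) ^ 2 ≤ 16 * G ^ 2 := by
    rw [min_comm]
    exact (min_sq_le_left (by positivity) (by positivity)).trans (le_of_eq (by ring))
  have h2 : (if a.K ∣ j then (P : ℝ)⁻¹ * (batchSize a j : ℝ)⁻¹ else (batchSize a j : ℝ)⁻¹) ≤ 1 := by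
    split_ifs
    · exact mul_le_one₀ (inv_le_one_of_one_le₀ hP') (by positivity) (inv_le_one_of_one_le₀ hm)
    · exact inv_le_one_of_one_le₀ hm
  calc _ ≤ 1 * (16 * G ^ 2) := mul_le_mul h2 h1 (sq_nonneg _) zero_le_one
    _ = _ := one_mul _

/-- The factor 1/K, due to the batch size Kb, is set apart to cancel the K lost by Cauchy–Schwarz
across a round. -/
lemma stepVar_le_of_dvd (hP : 0 < P) (hK : 0 < a.K) (hb : 0 < a.b) {L G : ℝ} (hL : 0 ≤ L)
    (hG : 0 ≤ G) {j : ℕ} (hj : a.K ∣ j) :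
    stepVar pb a u L G j ≤
      4 * L ^ 2 / (P * a.b) * ((a.K : ℝ)⁻¹ * ‖iterate pb a u j - anchor pb a u j‖ ^ 2) := by
  rw [stepVar_eq hP hK hb, if_pos hj]
  refine (mul_le_mul_of_nonneg_left (min_sq_le_left (by positivity) (by positivity))
    (by positivity)).trans (le_of_eq ?_)
  rw [batchSize, if_pos hj]
  push_cast
  field_simp
  ring

lemma stepVar_le_of_not_dvd (hP : 0 < P) (hK : 0 < a.K) (hb : 0 < a.b) {L G : ℝ} (hL : 0 ≤ L)
    (hG : 0 ≤ G) {j : ℕ} (hj : ¬ a.K ∣ j) :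
    stepVar pb a u L G j ≤ 4 * L ^ 2 / a.b * ‖iterate pb a u j - anchor pb a u j‖ ^ 2 := by
  rw [stepVar_eq hP hK hb, if_neg hj]
  have hm : (a.b : ℝ) ≤ batchSize a j := by exact_mod_cast batchSize_ge hK j
  have hb' : (0 : ℝ) < a.b := by exact_mod_cast hb
  calc _ ≤ (a.b : ℝ)⁻¹ * (2 * L * ‖iterate pb a u j - anchor pb a u j‖) ^ 2 :=
        mul_le_mul (inv_anti₀ hb' hm) (min_sq_le_left (by positivity) (by positivity))
          (sq_nonneg _) (by positivity)
    _ = _ := by field_simp; ring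

lemma sum_stepVar_active_le (hP : 0 < P) (hK : 0 < a.K) (hb : 0 < a.b) {L G : ℝ} (hL : 0 ≤ L)
    (hG : 0 ≤ G) (i : ℕ) :
    ∑ j ∈ active a.K a.T i, stepVar pb a u L G j ≤ i * (16 * G ^ 2) := by
  calc _ ≤ ∑ j ∈ active a.K a.T i, 16 * G ^ 2 :=
        Finset.sum_le_sum fun j _ => stepVar_le hP hK hb hL hG j
    _ ≤ ∑ j ∈ Finset.Ioc 0 i, 16 * G ^ 2 :=
        Finset.sum_le_sum_of_subset_of_nonneg (active_subset _ _ i) fun _ _ _ => by positivity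
    _ = _ := by simp

lemma xRound_eq (i : ℕ) :
    (run pb a u i).xRound = iterate pb a u (a.K * (i / a.K)) := by
  induction i with
  | zero => simp [iterate, run, epochStart]
  | succ i ih =>
    by_cases h2 : a.K ∣ i + 1
    · have h3 : a.K * ((i + 1) / a.K) = i + 1 := Nat.mul_div_cancel' h2
      rw [h3, iterate]
      simp only [run]
      split_ifs <;> rfl
    · have h1 : ¬ a.K * a.T ∣ i + 1 := fun h => h2 (dvd_of_mul_right_dvd h)
      rw [Nat.succ_div_of_not_dvd h2, ← ih]
      simp only [run, if_neg h1, if_neg h2]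
      rfl

/-- The estimators are the mean-field quantities minus the accumulated sampling errors. -/
lemma estimator_eq (hK : 0 < a.K) (hb : 0 < a.b) {L : ℝ}
    (hoff : pb.Offline) (hlip : pb.LossGradLipschitz L) (i : ℕ) :
    average (run pb a u i).vWorker = gradient pb.obj (run pb a u i).xRound
        - ∑ j ∈ (active a.K a.T i).filter (a.K ∣ ·), stepError pb a u j ∧
    (run pb a u i).v = gradient pb.obj (run pb a u i).xRound
        + (gradient (pb.localObj (u.worker (i / a.K))) (iterate pb a u i)
          - gradient (pb.localObj (u.worker (i / a.K))) (run pb a u i).xRound)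
        - ∑ j ∈ active a.K a.T i, stepError pb a u j := by
  induction i with
  | zero =>
    simp [active, run, epochStart, iterate, gradient_obj hoff hlip]
  | succ i ih =>
    obtain ⟨ih1, ih2⟩ := ih
    by_cases h1 : a.K * a.T ∣ i + 1
    · simp [active, run, epochStart, iterate, gradient_obj hoff hlip, h1]
    by_cases h2 : a.K ∣ i + 1
    · have hnot : i + 1 ∉ (active a.K a.T i).filter (a.K ∣ ·) := fun h =>
        succ_notMem_active _ _ i (Finset.filter_subset _ _ h)
      have hact : active a.K a.T (i + 1) =
          insert (i + 1) ((active a.K a.T i).filter (a.K ∣ ·)) := by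
        rw [active, if_neg h1, if_pos h2]
      -- A round start discards the local corrections of the previous round, so only corrections
      -- made at round starts survive.
      have hfil : (active a.K a.T (i + 1)).filter (a.K ∣ ·) = active a.K a.T (i + 1) := by
        rw [hact, Finset.filter_insert, if_pos h2, Finset.filter_filter]
        simp
      have hv : (run pb a u (i + 1)).v = average (run pb a u (i + 1)).vWorker := by
        simp only [run, if_neg h1, if_pos h2]
        rfl
      have hx : (run pb a u (i + 1)).xRound = iterate pb a u (i + 1) := by
        simp only [iterate, run, if_neg h1, if_pos h2]
        rfl
      have hmain : average (run pb a u (i + 1)).vWorker = gradient pb.obj (iterate pb a u (i + 1))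
          - ∑ j ∈ active a.K a.T (i + 1), stepError pb a u j := by
        have hw : (run pb a u (i + 1)).vWorker = fun p =>
            pb.batchGrad (a.K * a.b) (u.z p (i + 1)) (iterate pb a u (i + 1))
              - pb.batchGrad (a.K * a.b) (u.z p (i + 1)) (anchor pb a u (i + 1))
              + (run pb a u i).vWorker p := by
          simp only [iterate, anchor, run, if_neg h1, if_pos h2]
          rfl
        have hanc : anchor pb a u (i + 1) = (run pb a u i).xRound := if_pos h2
        rw [hact, Finset.sum_insert hnot, stepError_of_dvd hK hb h2, hw, average_sub, average_sub,
          ← gradient_obj hoff hlip, ← gradient_obj hoff hlip, hanc]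
        have hadd : ∀ X Y : Fin P → Vec d, average (fun p => X p + Y p) = average X + average Y :=
          fun X Y => by simp only [average, Finset.sum_add_distrib, smul_add]
        rw [hadd, ih1]
        abel
      rw [hfil, hv, hx]
      -- The current point is the start of the round, so the local difference vanishes whichever
      -- worker is selected.
      exact ⟨hmain, by rw [sub_self, add_zero, hmain]⟩
    · have hact : active a.K a.T (i + 1) = insert (i + 1) (active a.K a.T i) := by
        rw [active, if_neg h1, if_neg h2]
      have hw : (run pb a u (i + 1)).vWorker = (run pb a u i).vWorker := by
        simp only [run, if_neg h1, if_neg h2]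
        rfl
      have hr : (run pb a u (i + 1)).xRound = (run pb a u i).xRound := by
        simp only [run, if_neg h1, if_neg h2]
        rfl
      have hanc : anchor pb a u (i + 1) = iterate pb a u i := if_neg h2
      have hm : batchSize a (i + 1) = localBatch a.K a.b ((i + 1) % a.K) := if_neg h2
      have hv : (run pb a u (i + 1)).v =
          pb.batchGrad (batchSize a (i + 1)) (u.z (u.worker ((i + 1) / a.K)) (i + 1))
              (iterate pb a u (i + 1))
            - pb.batchGrad (batchSize a (i + 1)) (u.z (u.worker ((i + 1) / a.K)) (i + 1))
              (iterate pb a u i)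
            + (run pb a u i).v := by
        simp only [hm, iterate, run, if_neg h1, if_neg h2]
        rfl
      -- Consecutive iterations of a round have the same worker, so the local gradient differences
      -- telescope.
      rw [hw, hr, hact, Finset.filter_insert, if_neg h2, Finset.sum_insert
        (succ_notMem_active _ _ i), stepError_of_not_dvd hK hb h2, hv, hanc, ih2,
        Nat.succ_div_of_not_dvd h2]
      exact ⟨ih1, by abel⟩

/-- The squared displacement between two iterates. -/
lemma norm_sub_sq_le_sum {E : Type*} [NormedAddCommGroup E] (x : ℕ → E) {m n : ℕ} (h : m ≤ n) :
    ‖x n - x m‖ ^ 2 ≤ ((n - m : ℕ) : ℝ) * ∑ i ∈ Finset.Ico m n, ‖x (i + 1) - x i‖ ^ 2 := by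
  rw [← Finset.sum_Ico_sub x h]
  have := sq_sum_le_card_mul_sum_sq (s := Finset.Ico m n) (f := fun i => ‖x (i + 1) - x i‖)
  rw [Nat.card_Ico] at this
  exact (pow_le_pow_left₀ (norm_nonneg _) (norm_sum_le _ _) 2).trans this

/-- The quadratic variation accumulated at round starts. -/
lemma sum_stepVar_round_le (hP : 0 < P) (hK : 0 < a.K) (hb : 0 < a.b) {L G : ℝ} (hL : 0 ≤ L)
    (hG : 0 ≤ G) (i : ℕ) :
    ∑ j ∈ (active a.K a.T i).filter (a.K ∣ ·), stepVar pb a u L G j ≤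
      4 * L ^ 2 / (P * a.b) *
        ∑ j ∈ Finset.Ico (a.K * a.T * (i / (a.K * a.T))) (a.K * (i / a.K)),
          ‖iterate pb a u (j + 1) - iterate pb a u j‖ ^ 2 := by
  induction i with
  | zero => simp [active]
  | succ i ih =>
    by_cases h1 : a.K * a.T ∣ i + 1
    · rw [active, if_pos h1, Finset.filter_empty, Finset.sum_empty]
      positivity
    rw [Nat.succ_div_of_not_dvd h1]
    by_cases h2 : a.K ∣ i + 1
    · have hnot : i + 1 ∉ (active a.K a.T i).filter (a.K ∣ ·) := fun h =>
        succ_notMem_active _ _ i (Finset.filter_subset _ _ h)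
      rw [active, if_neg h1, if_pos h2, Finset.filter_insert, if_pos h2, Finset.filter_filter]
      simp only [and_self]
      have h3 : a.K * ((i + 1) / a.K) = i + 1 := Nat.mul_div_cancel' h2
      have h4 : a.K * (i / a.K) + a.K = i + 1 := by
        rw [← h3, Nat.succ_div_of_dvd h2]
        ring
      have h5 : a.K * a.T * (i / (a.K * a.T)) ≤ a.K * (i / a.K) := by
        rw [mul_assoc, ← Nat.div_div_eq_div_mul]
        exact Nat.mul_le_mul_left _ (Nat.mul_div_le _ _)
      have hanc : anchor pb a u (i + 1) = iterate pb a u (a.K * (i / a.K)) :=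
        (if_pos h2).trans (xRound_eq i)
      rw [Finset.sum_insert hnot, h3,
        ← Finset.sum_Ico_consecutive _ h5 (by omega : a.K * (i / a.K) ≤ i + 1), mul_add, add_comm]
      refine add_le_add ih ((stepVar_le_of_dvd hP hK hb hL hG h2).trans ?_)
      refine mul_le_mul_of_nonneg_left ?_ (by positivity)
      -- Cauchy–Schwarz over the K steps of the completed round.
      have h6 := norm_sub_sq_le_sum (iterate pb a u) (by omega : a.K * (i / a.K) ≤ i + 1)
      rw [show i + 1 - a.K * (i / a.K) = a.K by omega] at h6
      rw [hanc, inv_mul_le_iff₀ (by positivity)]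
      exact h6
    · rw [active, if_neg h1, if_neg h2, Finset.filter_insert, if_neg h2, Nat.succ_div_of_not_dvd h2]
      exact ih

/-- The quadratic variation accumulated inside the current round. -/
lemma sum_stepVar_local_le (hP : 0 < P) (hK : 0 < a.K) (hb : 0 < a.b) {L G : ℝ} (hL : 0 ≤ L)
    (hG : 0 ≤ G) (i : ℕ) :
    ∑ j ∈ (active a.K a.T i).filter (¬ a.K ∣ ·), stepVar pb a u L G j ≤
      4 * L ^ 2 / a.b *
        ∑ j ∈ Finset.Ico (a.K * (i / a.K)) i, ‖iterate pb a u (j + 1) - iterate pb a u j‖ ^ 2 := by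
  induction i with
  | zero => simp [active]
  | succ i ih =>
    by_cases h2 : a.K ∣ i + 1
    · have : (active a.K a.T (i + 1)).filter (¬ a.K ∣ ·) = ∅ := by
        rw [active]
        split_ifs
        · simp
        · rw [Finset.filter_insert, if_neg (not_not.2 h2), Finset.filter_filter]
          simp
      rw [this, Finset.sum_empty]
      positivity
    · have h1 : ¬ a.K * a.T ∣ i + 1 := fun h => h2 (dvd_of_mul_right_dvd h)
      have hnot : i + 1 ∉ (active a.K a.T i).filter (¬ a.K ∣ ·) := fun h =>
        succ_notMem_active _ _ i (Finset.filter_subset _ _ h)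
      rw [active, if_neg h1, if_neg h2, Finset.filter_insert, if_pos h2, Finset.sum_insert hnot,
        Nat.succ_div_of_not_dvd h2, Finset.sum_Ico_succ_top (Nat.mul_div_le i a.K), mul_add,
        add_comm]
      refine add_le_add ih ((stepVar_le_of_not_dvd hP hK hb hL hG h2).trans (le_of_eq ?_))
      rw [show anchor pb a u (i + 1) = iterate pb a u i from if_neg h2]

/-- The displacement accumulated since the start of the current block of length `B`. -/
def blockSum (D : ℕ → ℝ) (B i : ℕ) : ℝ := ∑ j ∈ Finset.Ico (B * (i / B)) i, D j

lemma sum_stepVar_active_le_blockSum (hP : 0 < P) (hK : 0 < a.K) (hb : 0 < a.b) {L G : ℝ}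
    (hL : 0 ≤ L) (hG : 0 ≤ G) (i : ℕ) :
    ∑ j ∈ active a.K a.T i, stepVar pb a u L G j ≤
      4 * L ^ 2 / (P * a.b) *
        blockSum (fun j => ‖iterate pb a u (j + 1) - iterate pb a u j‖ ^ 2) (a.K * a.T) i
      + 4 * L ^ 2 / a.b *
        blockSum (fun j => ‖iterate pb a u (j + 1) - iterate pb a u j‖ ^ 2) a.K i := by
  rw [← Finset.sum_filter_add_sum_filter_not (active a.K a.T i) (a.K ∣ ·)]
  refine add_le_add ((sum_stepVar_round_le hP hK hb hL hG i).trans ?_)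
    (sum_stepVar_local_le hP hK hb hL hG i)
  refine mul_le_mul_of_nonneg_left ?_ (by positivity)
  exact Finset.sum_le_sum_of_subset_of_nonneg
    (Finset.Ico_subset_Ico_right (Nat.mul_div_le i a.K)) fun _ _ _ => sq_nonneg _

/-- The estimation error: sampling noise plus the drift due to heterogeneity. -/
lemma norm_gradient_sub_estimator_sq_le (hP : 0 < P) (hK : 0 < a.K) (hb : 0 < a.b) {L ζ : ℝ}
    (hoff : pb.Offline) (hlip : pb.LossGradLipschitz L) (hhet : pb.Heterogeneous ζ) (i : ℕ) :
    ‖gradient pb.obj (iterate pb a u i) - (run pb a u i).v‖ ^ 2 ≤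
      2 * ‖∑ j ∈ active a.K a.T i, stepError pb a u j‖ ^ 2
      + 2 * ζ ^ 2 * a.K *
        blockSum (fun j => ‖iterate pb a u (j + 1) - iterate pb a u j‖ ^ 2) a.K i := by
  have h1 := norm_heterogeneity_le hP hoff hlip hhet (u.worker (i / a.K)) (iterate pb a u i)
    (run pb a u i).xRound
  set H := (gradient pb.obj (iterate pb a u i)
    - gradient (pb.localObj (u.worker (i / a.K))) (iterate pb a u i))
    - (gradient pb.obj (run pb a u i).xRound
      - gradient (pb.localObj (u.worker (i / a.K))) (run pb a u i).xRound) with hH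
  set M := ∑ j ∈ active a.K a.T i, stepError pb a u j with hM
  have h2 : gradient pb.obj (iterate pb a u i) - (run pb a u i).v = M + H := by
    rw [(estimator_eq hK hb hoff hlip i).2, hH, hM]
    abel
  have h3 : ‖H‖ ^ 2 ≤ ζ ^ 2 * (a.K * blockSum
      (fun j => ‖iterate pb a u (j + 1) - iterate pb a u j‖ ^ 2) a.K i) := by
    refine (pow_le_pow_left₀ (norm_nonneg _) h1 2).trans ?_
    rw [mul_pow, xRound_eq]
    refine mul_le_mul_of_nonneg_left ?_ (sq_nonneg ζ)
    refine (norm_sub_sq_le_sum (iterate pb a u) (Nat.mul_div_le i a.K)).trans ?_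
    refine mul_le_mul_of_nonneg_right ?_ (Finset.sum_nonneg fun _ _ => sq_nonneg _)
    have := Nat.div_add_mod i a.K
    have := Nat.mod_lt i hK
    exact_mod_cast (by omega : i - a.K * (i / a.K) ≤ a.K)
  rw [h2]
  have h4 := norm_add_le M H
  nlinarith [sq_nonneg (‖M‖ - ‖H‖), norm_nonneg (M + H), norm_nonneg M, norm_nonneg H]

end Decomposition

-- Summation over rounds and epochs

section Blocks

/-- Summing the displacements accumulated inside blocks of length `B`. -/
lemma sum_blockSum_le {D : ℕ → ℝ} (hD : ∀ i, 0 ≤ D i) {B : ℕ} (hB : 0 < B) {i₀ i₁ n : ℕ}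
    (h₁ : i₀ ≤ i₁) (hn : n ≤ B * (i₀ / B)) :
    ∑ i ∈ Finset.Ico i₀ i₁, blockSum D B i ≤
      B * ∑ j ∈ Finset.Ico i₀ i₁, D j
        + ((min (i₁ - i₀) B : ℕ) : ℝ) * ∑ j ∈ Finset.Ico n i₀, D j := by
  have hsub : ∀ i ∈ Finset.Ico i₀ i₁, Finset.Ico (B * (i / B)) i ⊆
      (Finset.Ico n i₁).filter fun j => B * (i / B) ≤ j ∧ j < i := fun i hi j hj => by
    have h2 := Finset.mem_Ico.1 hi
    have h3 := Finset.mem_Ico.1 hj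
    have h4 : B * (i₀ / B) ≤ B * (i / B) := Nat.mul_le_mul_left _ (Nat.div_le_div_right h2.1)
    simp only [Finset.mem_filter, Finset.mem_Ico]
    omega
  -- The displacement at j enters only the block sums of later i in the same block, hence of i in
  -- (j, j + B].
  have hcount : ∀ j, ((Finset.Ico i₀ i₁).filter fun i => B * (i / B) ≤ j ∧ j < i).card ≤ B :=
    fun j => by
      have : ((Finset.Ico i₀ i₁).filter fun i => B * (i / B) ≤ j ∧ j < i) ⊆
          Finset.Ioc j (j + B) := fun i hi => by
        simp only [Finset.mem_filter, Finset.mem_Ioc] at hi ⊢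
        have := Nat.div_add_mod i B
        have := Nat.mod_lt i hB
        omega
      simpa using Finset.card_le_card this
  have hcount' : ∀ j, ((Finset.Ico i₀ i₁).filter fun i => B * (i / B) ≤ j ∧ j < i).card ≤
      i₁ - i₀ := fun j => by
    simpa using Finset.card_filter_le (Finset.Ico i₀ i₁) fun i => B * (i / B) ≤ j ∧ j < i
  have hni : n ≤ i₀ := hn.trans (Nat.mul_div_le i₀ B)
  calc ∑ i ∈ Finset.Ico i₀ i₁, blockSum D B i
      ≤ ∑ i ∈ Finset.Ico i₀ i₁, ∑ j ∈ Finset.Ico n i₁,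
          if B * (i / B) ≤ j ∧ j < i then D j else 0 := by
        refine Finset.sum_le_sum fun i hi => ?_
        rw [← Finset.sum_filter]
        exact Finset.sum_le_sum_of_subset_of_nonneg (hsub i hi) fun j _ _ => hD j
    _ = ∑ j ∈ Finset.Ico n i₁,
          (((Finset.Ico i₀ i₁).filter fun i => B * (i / B) ≤ j ∧ j < i).card : ℝ) * D j := by
        rw [Finset.sum_comm]
        refine Finset.sum_congr rfl fun j _ => ?_
        rw [← Finset.sum_filter, Finset.sum_const, nsmul_eq_mul]
    _ ≤ ∑ j ∈ Finset.Ico n i₀, ((min (i₁ - i₀) B : ℕ) : ℝ) * D j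
          + ∑ j ∈ Finset.Ico i₀ i₁, (B : ℝ) * D j := by
        rw [← Finset.sum_Ico_consecutive _ hni h₁]
        refine add_le_add (Finset.sum_le_sum fun j _ => ?_) (Finset.sum_le_sum fun j _ => ?_)
        · exact mul_le_mul_of_nonneg_right
            (by exact_mod_cast le_min (hcount' j) (hcount j)) (hD j)
        · exact mul_le_mul_of_nonneg_right (by exact_mod_cast hcount j) (hD j)
    _ = _ := by rw [← Finset.mul_sum, ← Finset.mul_sum, add_comm]

/-- Displacements of the current round also enter the epoch sums; this lets their epoch weight be
absorbed into the round weight. -/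
lemma min_div_mul_le {Δ K T : ℕ} (hK : 0 < K) (hT : 0 < T) :
    ((min Δ (K * T) : ℕ) : ℝ) / ((K : ℝ) * T) ≤ ((min Δ K : ℕ) : ℝ) / K := by
  have hK' : (0 : ℝ) < K := by exact_mod_cast hK
  have hT' : (1 : ℝ) ≤ T := by exact_mod_cast hT
  rw [div_le_div_iff₀ (by positivity) hK']
  have : min Δ (K * T) ≤ min Δ K * T := by
    rcases le_total Δ K with h | h
    · rw [min_eq_left h]
      exact (min_le_left _ _).trans (Nat.le_mul_of_pos_right _ hT)
    · rw [min_eq_right h]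
      exact min_le_right _ _
  calc ((min Δ (K * T) : ℕ) : ℝ) * K ≤ ((min Δ K * T : ℕ) : ℝ) * K := by gcongr
    _ = _ := by push_cast; ring

end Blocks

-- Deterministic descent on the good event

section Descent

variable {Z : Type*} {d P : ℕ} {pb : Problem d P Z} {a : Params d} {u : Draws d P Z}

lemma iterate_succ_sub (i : ℕ) : iterate pb a u (i + 1) - iterate pb a u i =
    -(a.η • ((run pb a u i).v - u.ξ (i + 1))) := by
  have : iterate pb a u (i + 1) = ((run pb a u i).x - a.η • (run pb a u i).v)
      + a.η • u.ξ (i + 1) := by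
    simp only [iterate, run]
    split_ifs <;> rfl
  rw [this, iterate, smul_sub]
  abel

/-- One step of gradient descent with an inexact gradient and a bounded perturbation. -/
lemma one_step_descent {f : Vec d → ℝ} {L η r : ℝ} (hL : 0 ≤ L) (hη : 0 < η)
    (hf : GradLipschitz L f) {x y v ξ : Vec d} (hy : y - x = -(η • (v - ξ))) (hξ : ‖ξ‖ ≤ r) :
    f y ≤ f x - η / 2 * ‖gradient f x‖ ^ 2 - (1 / (2 * η) - L) * ‖y - x‖ ^ 2
      + 3 / 2 * η * ‖gradient f x - v‖ ^ 2 + 3 / 4 * η * r ^ 2 := by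
  have h1 := hf.le_taylor hL x y
  have hin : inner ℝ (gradient f x) (y - x) = -(η * inner ℝ (gradient f x) (v - ξ)) := by
    rw [hy, inner_neg_right, inner_smul_right]
  have hno : ‖y - x‖ ^ 2 = η ^ 2 * ‖v - ξ‖ ^ 2 := by
    rw [hy, norm_neg, norm_smul, mul_pow, Real.norm_of_nonneg hη.le]
  -- Polarization turns the inner product into -(η/2)‖∇f‖², half the squared displacement over η,
  -- and the error term.
  have hpol := norm_sub_sq_real (gradient f x) (v - ξ)
  -- The unequal weights 3 and 3/2 come from 4ab ≤ 4a² + b². They leave ηr²/4 of the perturbation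
  -- budget for the noise floor.
  have htri : ‖gradient f x - (v - ξ)‖ ^ 2 ≤ 3 * ‖gradient f x - v‖ ^ 2 + 3 / 2 * r ^ 2 := by
    have h2 : gradient f x - (v - ξ) = (gradient f x - v) + ξ := by abel
    have h3 : ‖gradient f x - (v - ξ)‖ ≤ ‖gradient f x - v‖ + r := by
      rw [h2]
      exact (norm_add_le _ _).trans (by gcongr)
    refine (pow_le_pow_left₀ (norm_nonneg _) h3 2).trans ?_
    nlinarith [sq_nonneg (2 * ‖gradient f x - v‖ - r)]
  have hη2 : 1 / (2 * η) * ‖y - x‖ ^ 2 = η / 2 * ‖v - ξ‖ ^ 2 := by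
    rw [hno]
    field_simp
  have h4 := mul_le_mul_of_nonneg_left htri (by positivity : 0 ≤ η / 2)
  rw [hpol] at h4
  rw [sub_mul, hη2]
  rw [hin] at h1
  nlinarith

lemma idx_le {K T S k t s : ℕ} (hk : k ≤ K) (ht : t < T) (hs : s < S) :
    idx K T k t s ≤ K * T * S := by
  have h1 : K * (t + 1) ≤ K * T := Nat.mul_le_mul_left _ ht
  have h2 : K * T * (s + 1) ≤ K * T * S := Nat.mul_le_mul_left _ hs
  rw [idx]
  nlinarith

/-- Only an inequality: for k = K the index I(K, t, s) is already the start of the next round. -/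
lemma idx_round_le (K T k t s : ℕ) (hK : 0 < K) :
    idx K T 0 t s ≤ K * (idx K T k t s / K) := by
  have h : idx K T 0 t s = K * (t + T * s) := by rw [idx]; ring
  rw [h]
  refine Nat.mul_le_mul_left _ ((Nat.le_div_iff_mul_le hK).2 ?_)
  rw [idx]
  nlinarith

lemma idx_epoch_le (K T k t s : ℕ) (hKT : 0 < K * T) :
    idx K T 0 0 s ≤ K * T * (idx K T k t s / (K * T)) := by
  have h : idx K T 0 0 s = K * T * s := by rw [idx]; ring
  rw [h]
  refine Nat.mul_le_mul_left _ ((Nat.le_div_iff_mul_le hKT).2 ?_)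
  rw [idx]
  nlinarith

/-- The noise of one step is paid for by the perturbation budget and the displacements. -/
lemma noise_budget {h l ε e m V β y E B R : ℝ} (hh : 0 ≤ h) (hl : 0 ≤ l) (hε0 : 0 ≤ ε)
    (hε : (108 * l + 3) * ε ≤ 1 / 16) (hE : 0 ≤ E) (hB : 0 ≤ B) (h1 : e ≤ 2 * m + y)
    (h2 : m ≤ 9 * l * (V + β)) (h3 : h * V ≤ 4 * ε * E + 4 * ε * B) (h4 : h * y ≤ 2 * ε * B)
    (hβ : 108 * l * β ≤ R) :
    3 / 2 * (h * e) ≤ 1 / 4 * (h * R) + 1 / 16 * (E + B) := by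
  -- Multiplying by 3/2 turns 18l into 27l. The constant 108 = 4·27 then serves twice: for the
  -- factor 4ε in V and for the quarter of R left to β.
  have h5 : h * e ≤ h * (18 * l * (V + β)) + h * y := by
    rw [← mul_add]
    exact mul_le_mul_of_nonneg_left (by linarith) hh
  have h6 := mul_le_mul_of_nonneg_left h3 (by positivity : 0 ≤ 27 * l)
  have h7 := mul_le_mul_of_nonneg_left hβ hh
  have h8 := mul_le_mul_of_nonneg_right hε (add_nonneg hE hB)
  have h9 : 0 ≤ ε * E := mul_nonneg hε0 hE
  linarith

/-- The descent inequality holds on every realization for which the sampling noise is controlled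
by its quadratic variation. -/
theorem descentIneq_of_noise_le (hP : 0 < P) (hK : 0 < a.K) (hb : 0 < a.b) (hT : 0 < a.T)
    {L ζ G r l β ε : ℝ} (hL : 0 ≤ L) (hG : 0 ≤ G) (hη : 0 < a.η) (hl : 0 < l)
    (hoff : pb.Offline) (hlip : pb.LossGradLipschitz L) (hhet : pb.Heterogeneous ζ)
    (hβ : 108 * l * β ≤ r ^ 2) (hεL : a.η * L ≤ 1 / 8)
    (hεζ : a.η ^ 2 * ζ ^ 2 * a.K ^ 2 ≤ ε)
    (hεb : a.η ^ 2 * L ^ 2 * a.K / a.b ≤ ε)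
    (hεP : a.η ^ 2 * L ^ 2 * (a.K * a.T) / (P * a.b) ≤ ε)
    (hε : (108 * l + 3) * ε ≤ 1 / 16) {S : ℕ} (hξ : ∀ i, ‖u.ξ i‖ ≤ r)
    (hnoise : ∀ i < a.K * a.T * S, ‖∑ j ∈ active a.K a.T i, stepError pb a u j‖ ^ 2 ≤
      9 * l * (∑ j ∈ active a.K a.T i, stepVar pb a u L G j + β))
    {k₀ t₀ s₀ k t s : ℕ} (hk : k ≤ a.K) (ht : t < a.T) (hs : s < S)
    (hle : idx a.K a.T k₀ t₀ s₀ ≤ idx a.K a.T k t s) :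
    DescentIneq pb.obj (iterate pb a u) a.η r 1 a.K a.T k₀ t₀ s₀ k t s := by
  set x := iterate pb a u with hx
  set D : ℕ → ℝ := fun i => ‖x (i + 1) - x i‖ ^ 2 with hD
  have hD0 : ∀ i, 0 ≤ D i := fun i => sq_nonneg _
  set η := a.η with hηdef
  have hK' : (0 : ℝ) < a.K := by exact_mod_cast hK
  have hT' : (0 : ℝ) < a.T := by exact_mod_cast hT
  have hb' : (0 : ℝ) < a.b := by exact_mod_cast hb
  have hP' : (0 : ℝ) < P := by exact_mod_cast hP
  have hblock : ∀ B i, 0 ≤ blockSum D B i := fun B i => Finset.sum_nonneg fun j _ => hD0 j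
  have hε0 : 0 ≤ ε := le_trans (by positivity) hεζ
  have herr : ∀ i < a.K * a.T * S, 3 / 2 * η * ‖gradient pb.obj (x i) - (run pb a u i).v‖ ^ 2 ≤
      1 / 4 * η * r ^ 2 + (1 / 16) / η * (blockSum D (a.K * a.T) i / (a.K * a.T)
        + blockSum D a.K i / a.K) := by
    intro i hi
    have h1 := norm_gradient_sub_estimator_sq_le (a := a) (u := u) hP hK hb hoff hlip hhet i
    have h2 := hnoise i hi
    have h3 := sum_stepVar_active_le_blockSum (pb := pb) (a := a) (u := u) hP hK hb hL hG i
    rw [← hx] at h1 h3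
    change _ ≤ 2 * _ + 2 * ζ ^ 2 * a.K * blockSum D a.K i at h1
    change _ ≤ 4 * L ^ 2 / (P * a.b) * blockSum D (a.K * a.T) i
      + 4 * L ^ 2 / a.b * blockSum D a.K i at h3
    set eE := blockSum D (a.K * a.T) i with heE
    set eB := blockSum D a.K i with heB
    have hE0 : 0 ≤ eE / (a.K * a.T) := div_nonneg (hblock _ _) (by positivity)
    have hB0 : 0 ≤ eB / a.K := div_nonneg (hblock _ _) hK'.le
    have hEe : η ^ 2 * (4 * L ^ 2 / (P * a.b) * eE) ≤ 4 * ε * (eE / (a.K * a.T)) := by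
      have := mul_le_mul_of_nonneg_right hεP hE0
      calc _ = 4 * (η ^ 2 * L ^ 2 * (a.K * a.T) / (P * a.b) * (eE / (a.K * a.T))) := by
            field_simp
        _ ≤ _ := by linarith
    have hBe : η ^ 2 * (4 * L ^ 2 / a.b * eB) ≤ 4 * ε * (eB / a.K) := by
      have := mul_le_mul_of_nonneg_right hεb hB0
      calc _ = 4 * (η ^ 2 * L ^ 2 * a.K / a.b * (eB / a.K)) := by field_simp
        _ ≤ _ := by linarith
    have hζe : η ^ 2 * (2 * ζ ^ 2 * a.K * eB) ≤ 2 * ε * (eB / a.K) := by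
      have := mul_le_mul_of_nonneg_right hεζ hB0
      calc _ = 2 * (η ^ 2 * ζ ^ 2 * a.K ^ 2 * (eB / a.K)) := by field_simp
        _ ≤ _ := by linarith
    set V := ∑ j ∈ active a.K a.T i, stepVar pb a u L G j with hV
    have hη2 : 0 < η ^ 2 := by positivity
    have h4 : η ^ 2 * V ≤ 4 * ε * (eE / (a.K * a.T)) + 4 * ε * (eB / a.K) := by
      have := mul_le_mul_of_nonneg_left h3 hη2.le
      rw [mul_add] at this
      linarith
    have h11 := noise_budget hη2.le hl.le hε0 hε hE0 hB0 h1 h2 h4 hζe hβ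
    have h12 := div_le_div_of_nonneg_right h11 hη.le
    calc _ = 3 / 2 * (η ^ 2 * ‖gradient pb.obj (x i) - (run pb a u i).v‖ ^ 2) / η := by
          field_simp
      _ ≤ _ := h12
      _ = _ := by field_simp
  set i₀ := idx a.K a.T k₀ t₀ s₀ with hi₀
  set i₁ := idx a.K a.T k t s with hi₁'
  set Δ : ℕ := i₁ - i₀ with hΔ
  have hi₁ : i₁ ≤ a.K * a.T * S := idx_le hk ht hs
  have hsum : pb.obj (x i₁) - pb.obj (x i₀) ≤ ∑ i ∈ Finset.Ico i₀ i₁,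
      (-(η / 2) * ‖gradient pb.obj (x i)‖ ^ 2 - 3 / 8 / η * D i + η * r ^ 2
        + (1 / 16) / η * (blockSum D (a.K * a.T) i / (a.K * a.T) + blockSum D a.K i / a.K)) := by
    rw [← Finset.sum_Ico_sub (fun i => pb.obj (x i)) hle]
    refine Finset.sum_le_sum fun i hi => ?_
    have hi' := (Finset.mem_Ico.1 hi).2
    have h1 := one_step_descent hL hη (gradLipschitz_obj hP hoff hlip)
      (iterate_succ_sub (pb := pb) (a := a) (u := u) i) (hξ (i + 1))
    have h2 := herr i (hi'.trans_le hi₁)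
    -- Uses ηL ≤ 1/8. Of this 3/8, the summed errors take back 1/16 for rounds and 1/16 for epochs,
    -- and 1/4 remains.
    have h3 : 3 / 8 / η * D i ≤ (1 / (2 * η) - L) * D i := by
      refine mul_le_mul_of_nonneg_right ?_ (hD0 i)
      rw [div_le_iff₀ hη, sub_mul, div_mul_eq_mul_div, one_mul, div_mul_cancel_right₀ hη.ne']
      linarith
    change _ ≤ _ - _ - (1 / (2 * η) - L) * D i + _ + _ at h1
    linarith
  have hE := sum_blockSum_le hD0 (Nat.mul_pos hK hT) hle
    (idx_epoch_le a.K a.T k₀ t₀ s₀ (Nat.mul_pos hK hT))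
  have hB := sum_blockSum_le hD0 hK hle (idx_round_le a.K a.T k₀ t₀ s₀ hK)
  have hsplit := Finset.sum_Ico_consecutive D
    (by rw [idx, idx]; simp : idx a.K a.T 0 0 s₀ ≤ idx a.K a.T 0 t₀ s₀)
    (by change _ ≤ idx a.K a.T k₀ t₀ s₀; rw [idx, idx]; omega : idx a.K a.T 0 t₀ s₀ ≤ i₀)
  rw [← hsplit, ← hΔ] at hE
  rw [← hΔ] at hB
  set A := ∑ j ∈ Finset.Ico i₀ i₁, D j with hA
  set Mid := ∑ j ∈ Finset.Ico (idx a.K a.T 0 t₀ s₀) i₀, D j with hMid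
  set Fst := ∑ j ∈ Finset.Ico (idx a.K a.T 0 0 s₀) (idx a.K a.T 0 t₀ s₀), D j with hFst
  have hA0 : 0 ≤ A := Finset.sum_nonneg fun j _ => hD0 j
  have hMid0 : 0 ≤ Mid := Finset.sum_nonneg fun j _ => hD0 j
  have hFst0 : 0 ≤ Fst := Finset.sum_nonneg fun j _ => hD0 j
  set mB : ℝ := ((min Δ a.K : ℕ) : ℝ) / a.K with hmB
  set mE : ℝ := ((min Δ (a.K * a.T) : ℕ) : ℝ) / ((a.K : ℝ) * a.T) with hmE
  have hmle : mE ≤ mB := min_div_mul_le hK hT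
  have hmE0 : 0 ≤ mE := by positivity
  have hmB0 : 0 ≤ mB := by positivity
  have hE' : (∑ i ∈ Finset.Ico i₀ i₁, blockSum D (a.K * a.T) i) / (a.K * a.T) ≤
      A + mE * (Fst + Mid) := by
    rw [div_le_iff₀ (by positivity)]
    refine hE.trans (le_of_eq ?_)
    rw [hmE]
    push_cast
    field_simp
  have hB' : (∑ i ∈ Finset.Ico i₀ i₁, blockSum D a.K i) / a.K ≤ A + mB * Mid := by
    rw [div_le_iff₀ hK']
    refine hB.trans (le_of_eq ?_)
    rw [hmB]
    field_simp
  have hcard : ((Finset.Ico i₀ i₁).card : ℝ) = Δ := by rw [Nat.card_Ico]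
  simp only [Finset.sum_add_distrib, Finset.sum_sub_distrib, ← Finset.mul_sum, Finset.sum_const,
    ← Finset.sum_div, nsmul_eq_mul, hcard] at hsum
  have hfin : (1 / 16) / η * ((∑ i ∈ Finset.Ico i₀ i₁, blockSum D (a.K * a.T) i) / (a.K * a.T)
      + (∑ i ∈ Finset.Ico i₀ i₁, blockSum D a.K i) / a.K) ≤
      1 / 8 / η * A + 1 / η * (mB * Mid + mE * Fst) := by
    have h1 : mE * Mid ≤ mB * Mid := mul_le_mul_of_nonneg_right hmle hMid0
    have h2 : 0 ≤ mB * Mid := by positivity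
    have h3 : 0 ≤ mE * Fst := by positivity
    have h4 := mul_le_mul_of_nonneg_left
      (by linarith : (1 / 16 : ℝ) * ((∑ i ∈ Finset.Ico i₀ i₁, blockSum D (a.K * a.T) i) / (a.K * a.T)
        + (∑ i ∈ Finset.Ico i₀ i₁, blockSum D a.K i) / a.K) ≤
        1 / 8 * A + (mB * Mid + mE * Fst)) (one_div_nonneg.2 hη.le)
    calc _ = _ := by ring
      _ ≤ _ := h4
      _ = _ := by ring
  have hA4 : 1 / (4 * η) * A = 3 / 8 / η * A - 1 / 8 / η * A := by
    field_simp
    ring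
  change _ ≤ _ - _ + η * Δ * r ^ 2 + (-(1 / (4 * η)) * A + 1 / η * (mB * Mid + mE * Fst))
  linarith

end Descent

-- Self-normalized concentration

section Noise

/-- Optimizing an exponential tail bound over a geometric grid of parameters. -/
lemma sq_le_of_forall_grid {l β M V : ℝ} (hl : 0 < l) (hβ : 0 < β) (hM : 0 ≤ M) (hV : 0 ≤ V)
    {J : ℕ} (hJ : V + β < β * 4 ^ J)
    (h : ∀ j < J, √(l / (β * 4 ^ j)) * M ≤ l + √(l / (β * 4 ^ j)) ^ 2 * V / 2) :
    M ^ 2 ≤ 9 * l * (V + β) := by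
  classical
  -- The first such n is j + 1 with s = β·4ʲ ≤ V + β < 4s. For t² = l/s this gives t²V ≤ 4l, so tM ≤
  -- 3l and M² ≤ 9ls.
  have hex : ∃ n : ℕ, V + β < β * 4 ^ n := ⟨J, hJ⟩
  have hn0 : Nat.find hex ≠ 0 := fun h0 => by
    have := Nat.find_spec hex
    rw [h0, pow_zero, mul_one] at this
    linarith
  obtain ⟨j, hj⟩ := Nat.exists_eq_succ_of_ne_zero hn0
  have hup := Nat.find_spec hex
  have hjJ : j < J := by
    have := Nat.find_min' hex hJ
    omega
  have hlo : β * 4 ^ j ≤ V + β := not_lt.1 (Nat.find_min hex (by omega : j < Nat.find hex))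
  rw [hj, Nat.succ_eq_add_one, pow_succ] at hup
  have hs : 0 < β * 4 ^ j := by positivity
  have key := h j hjJ
  set s := β * 4 ^ j with hsdef
  set t := √(l / s) with ht
  have ht2 : t ^ 2 = l / s := Real.sq_sqrt (by positivity)
  have ht0 : 0 ≤ t := Real.sqrt_nonneg _
  have h1 : t ^ 2 * V ≤ 4 * l := by
    rw [ht2, div_mul_eq_mul_div, div_le_iff₀ hs]
    nlinarith
  have h2 : (t * M) ^ 2 ≤ (3 * l) ^ 2 := pow_le_pow_left₀ (by positivity) (by linarith) 2
  rw [mul_pow, ht2, div_mul_eq_mul_div, div_le_iff₀ hs] at h2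
  have h3 : M ^ 2 ≤ 9 * l * s := by
    have : l * M ^ 2 ≤ l * (9 * l * s) := by linarith
    exact le_of_mul_le_mul_left this hl
  exact h3.trans (mul_le_mul_of_nonneg_left hlo (by positivity))

/-- The factor 1/2 in the threshold matches cosh u ≥ eᵘ/2; by Markov it becomes the factor 2 in the
tail bound. -/
lemma le_of_expMart_lt {E : Type*} [NormedAddCommGroup E] {t l V : ℝ} {M : E}
    (h : expMart t M V < ENNReal.ofReal (Real.exp l / 2)) : t * ‖M‖ ≤ l + t ^ 2 * V / 2 := by
  rw [expMart, ENNReal.ofReal_lt_ofReal_iff (by positivity)] at h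
  have h1 : Real.exp (t * ‖M‖) / 2 ≤ Real.cosh (t * ‖M‖) := by
    rw [Real.cosh_eq]
    have := Real.exp_pos (-(t * ‖M‖))
    linarith
  have h2 : Real.exp (t * ‖M‖ - t ^ 2 * V / 2) / 2 < Real.exp l / 2 := by
    refine lt_of_le_of_lt ?_ h
    rw [sub_eq_add_neg, Real.exp_add, mul_div_right_comm]
    exact mul_le_mul_of_nonneg_right h1 (Real.exp_pos _).le
  have h3 := Real.exp_lt_exp.1 ((div_lt_div_iff_of_pos_right two_pos).1 h2)
  linarith

variable {Ω Z : Type*} {d P : ℕ} [MeasurableSpace Z] [DiscreteMeasurableSpace Z]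
  {U : Ω → Draws d P Z} [mΩ : MeasurableSpace Ω] {μ : Measure Ω} [IsProbabilityMeasure μ]
  {pb : Problem d P Z} {r L G : ℝ}

omit mΩ in
lemma measurable_iterate (hoff : pb.Offline) (hlip : pb.LossGradLipschitz L)
    (hmem : ∀ ω p i l, (U ω).z p i l ∈ (pb.D p).support) (a : Params d) (j : ℕ) :
    Measurable[history U (past j)] fun ω => iterate pb a (U ω) j :=
  (measurable_run hoff hlip hmem a j).1

omit mΩ in
lemma measurable_anchor (hoff : pb.Offline) (hlip : pb.LossGradLipschitz L)
    (hmem : ∀ ω p i l, (U ω).z p i l ∈ (pb.D p).support) (a : Params d) (j : ℕ) :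
    Measurable[history U (past j)] fun ω => anchor pb a (U ω) j := by
  have hle : history U (past (j - 1)) ≤ history U (past j) :=
    history_mono U (past_mono (Nat.sub_le j 1))
  have h := measurable_run hoff hlip hmem a (j - 1)
  unfold anchor
  split_ifs
  · exact h.2.1.mono hle le_rfl
  · exact h.1.mono hle le_rfl

omit mΩ [DiscreteMeasurableSpace Z] in
lemma measurable_sampleWeight (a : Params d) (p : Fin P) (j : ℕ) :
    Measurable[history U (past j)] fun ω => sampleWeight a (U ω) p j := by
  unfold sampleWeight
  split_ifs
  · exact measurable_const
  · exact (measurable_of_finite fun p' => if p' = p then (batchSize a j : ℝ)⁻¹ else 0).comp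
      (measurable_select_history U (n := j / a.K) trivial)

omit [MeasurableSpace Z] [DiscreteMeasurableSpace Z] in
lemma measurable_smul_noiseDiff {Ω' : Type*} [MeasurableSpace Ω'] (hoff : pb.Offline)
    (hlip : pb.LossGradLipschitz L) {p : Fin P} {z : Z} (hz : z ∈ (pb.D p).support)
    {w : Ω' → ℝ} {x y : Ω' → Vec d} (hw : Measurable w) (hx : Measurable x) (hy : Measurable y) :
    Measurable fun ω => w ω • pb.noiseDiff p (x ω) (y ω) z := by
  have h1 := measurable_gradient_localObj hoff hlip p
  have h2 := (continuous_lossGrad hlip hz).measurable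
  exact hw.smul (((h1.comp hx).sub (h1.comp hy)).sub ((h2.comp hx).sub (h2.comp hy)))

lemma measurable_mul_min {Ω' : Type*} [MeasurableSpace Ω'] (c C : ℝ)
    {w : Ω' → ℝ} {x y : Ω' → Vec d} (hw : Measurable w) (hx : Measurable x) (hy : Measurable y) :
    Measurable fun ω => w ω * min (c * ‖x ω - y ω‖) C :=
  hw.mul (((hx.sub hy).norm.const_mul c).min measurable_const)

omit mΩ in
lemma measurable_sampleError (hoff : pb.Offline) (hlip : pb.LossGradLipschitz L)
    (hmem : ∀ ω p i l, (U ω).z p i l ∈ (pb.D p).support) (a : Params d) (p : Fin P) (j : ℕ)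
    {z : Z} (hz : z ∈ (pb.D p).support) :
    Measurable[history U (past j)] fun ω => sampleError pb a (U ω) p j z :=
  @measurable_smul_noiseDiff Z d P pb L Ω (history U (past j)) hoff hlip p z hz _ _ _
    (measurable_sampleWeight a p j) (measurable_iterate hoff hlip hmem a j)
    (measurable_anchor hoff hlip hmem a j)

omit mΩ in
lemma measurable_sampleBound (hoff : pb.Offline) (hlip : pb.LossGradLipschitz L)
    (hmem : ∀ ω p i l, (U ω).z p i l ∈ (pb.D p).support) (a : Params d) (p : Fin P) (j : ℕ) :
    Measurable[history U (past j)] fun ω => sampleBound pb a (U ω) L G p j :=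
  @measurable_mul_min d Ω (history U (past j)) _ _ _ _ _
    (measurable_sampleWeight a p j) (measurable_iterate hoff hlip hmem a j)
    (measurable_anchor hoff hlip hmem a j)

/-- The exponential moment of the accumulated sampling error. -/
lemma lintegral_expMart_stepError_le (hU : IsSampling μ pb r U) (hoff : pb.Offline)
    (hlip : pb.LossGradLipschitz L) (hG : pb.LossGradBounded G)
    (hmem : ∀ ω p i l, (U ω).z p i l ∈ (pb.D p).support) (a : Params d) (A : Finset ℕ) (t : ℝ) :
    ∫⁻ ω, expMart t (∑ j ∈ A, stepError pb a (U ω) j) (∑ j ∈ A, stepVar pb a (U ω) L G j) ∂μ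
      ≤ 1 := by
  refine lintegral_expMart_le_one hU hoff hmem (batchSize a)
    (fun p j z ω => sampleError pb a (U ω) p j z) (fun p j ω => sampleBound pb a (U ω) L G p j)
    (fun p j z hz => measurable_sampleError hoff hlip hmem a p j hz)
    (fun p j => measurable_sampleBound hoff hlip hmem a p j) (fun p j ω => ?_)
    (fun p j z hz ω => ?_) t A
  · simp_rw [sampleError, smul_comm _ (sampleWeight a (U ω) p j), ← Finset.smul_sum]
    rw [sum_noiseDiff hoff hlip, smul_zero]
  · rw [sampleError, sampleBound, norm_smul, Real.norm_of_nonneg (sampleWeight_nonneg a (U ω) p j)]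
    exact mul_le_mul_of_nonneg_left (norm_noiseDiff_le hoff hlip hG p _ _ hz)
      (sampleWeight_nonneg a (U ω) p j)

omit [IsProbabilityMeasure μ] in
lemma measurable_expMart_stepError (hU : IsSampling μ pb r U) (hoff : pb.Offline)
    (hlip : pb.LossGradLipschitz L)
    (hmem : ∀ ω p i l, (U ω).z p i l ∈ (pb.D p).support) (a : Params d) (A : Finset ℕ) (t : ℝ) :
    Measurable fun ω =>
      expMart t (∑ j ∈ A, stepError pb a (U ω) j) (∑ j ∈ A, stepVar pb a (U ω) L G j) := by
  refine measurable_expMart t (Finset.measurable_fun_sum _ fun j _ =>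
    Finset.measurable_fun_sum _ fun q _ => ?_) (Finset.measurable_fun_sum _ fun j _ =>
    Finset.measurable_fun_sum _ fun q _ => Measurable.pow_const ?_ 2)
  · exact measurable_eval_sample (finSupport (pb.D q.1) (hoff q.1)) (hU.measurable_z q.1 j q.2)
      (fun ω => by simpa [finSupport] using hmem ω q.1 j q.2)
      (X := fun z ω => sampleError pb a (U ω) q.1 j z) fun z hz =>
      (measurable_sampleError hoff hlip hmem a q.1 j (mem_support_of_mem_finSupport hz)).mono
        (hU.history_le _) le_rfl
  · exact (measurable_sampleBound hoff hlip hmem a q.1 j).mono (hU.history_le _) le_rfl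

/-- Self-normalized concentration of the sampling errors, uniformly over `N` iterations. -/
theorem measure_noise_gt_le (hU : IsSampling μ pb r U) (hoff : pb.Offline)
    (hlip : pb.LossGradLipschitz L) (hG : pb.LossGradBounded G)
    (hmem : ∀ ω p i l, (U ω).z p i l ∈ (pb.D p).support) {a : Params d}
    (hP : 0 < P) (hK : 0 < a.K) (hb : 0 < a.b) (hL : 0 ≤ L) {l β : ℝ} (hl : 0 < l) (hβ : 0 < β)
    {N J : ℕ} (hJ : N * (16 * G ^ 2) + β < β * 4 ^ J) :
    μ {ω | ¬ ∀ i < N, ‖∑ j ∈ active a.K a.T i, stepError pb a (U ω) j‖ ^ 2 ≤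
      9 * l * (∑ j ∈ active a.K a.T i, stepVar pb a (U ω) L G j + β)} ≤
      ENNReal.ofReal (N * (J * (2 * Real.exp (-l)))) := by
  have hG0 := gradBound_nonneg hP hG
  set M : ℕ → Ω → Vec d := fun i ω => ∑ j ∈ active a.K a.T i, stepError pb a (U ω) j with hM
  set V : ℕ → Ω → ℝ := fun i ω => ∑ j ∈ active a.K a.T i, stepVar pb a (U ω) L G j with hV
  set t : ℕ → ℝ := fun j => √(l / (β * 4 ^ j)) with ht
  set bad : ℕ → ℕ → Set Ω := fun i j =>
    {ω | ENNReal.ofReal (Real.exp l / 2) ≤ expMart (t j) (M i ω) (V i ω)} with hbad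
  have hbad_le : ∀ i j, μ (bad i j) ≤ ENNReal.ofReal (2 * Real.exp (-l)) := fun i j => by
    have hpos : 0 < Real.exp l / 2 := by positivity
    have h1 := meas_ge_le_lintegral_div
      (measurable_expMart_stepError (G := G) hU hoff hlip hmem a (active a.K a.T i)
        (t j)).aemeasurable (μ := μ) (ENNReal.ofReal_pos.2 hpos).ne' ENNReal.ofReal_ne_top
    refine h1.trans ((ENNReal.div_le_div_right
      (lintegral_expMart_stepError_le hU hoff hlip hG hmem a _ _) _).trans (le_of_eq ?_))
    rw [one_div, ← ENNReal.ofReal_inv_of_pos hpos, Real.exp_neg, inv_div, div_eq_mul_inv]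
  have hsub : {ω | ¬ ∀ i < N, ‖M i ω‖ ^ 2 ≤ 9 * l * (V i ω + β)} ⊆
      ⋃ i ∈ Finset.range N, ⋃ j ∈ Finset.range J, bad i j := by
    intro ω hω
    by_contra hcon
    refine hω fun i hi => ?_
    have hV0 : 0 ≤ V i ω := Finset.sum_nonneg fun j _ => stepVar_nonneg L G j
    -- The bound coming from G places V + β below the last grid point on every realization.
    have hVN : V i ω ≤ N * (16 * G ^ 2) :=
      (sum_stepVar_active_le hP hK hb hL hG0 i).trans (by gcongr)
    refine sq_le_of_forall_grid hl hβ (norm_nonneg _) hV0 (by linarith : _ < β * 4 ^ J)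
      fun j hj => le_of_expMart_lt (M := M i ω) (not_le.1 fun hle => hcon ?_)
    exact Set.mem_biUnion (Finset.mem_coe.2 (Finset.mem_range.2 hi))
      (Set.mem_biUnion (Finset.mem_coe.2 (Finset.mem_range.2 hj)) hle)
  refine (measure_mono hsub).trans ?_
  calc μ (⋃ i ∈ Finset.range N, ⋃ j ∈ Finset.range J, bad i j)
      ≤ ∑ i ∈ Finset.range N, ∑ j ∈ Finset.range J, μ (bad i j) :=
        (measure_biUnion_finset_le _ _).trans
          (Finset.sum_le_sum fun i _ => measure_biUnion_finset_le _ _)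
    _ ≤ ∑ i ∈ Finset.range N, ∑ j ∈ Finset.range J, ENNReal.ofReal (2 * Real.exp (-l)) :=
        Finset.sum_le_sum fun i _ => Finset.sum_le_sum fun j _ => hbad_le i j
    _ = _ := by
        rw [Finset.sum_const, Finset.sum_const, Finset.card_range, Finset.card_range,
          nsmul_eq_mul, nsmul_eq_mul, ENNReal.ofReal_mul (Nat.cast_nonneg _),
          ENNReal.ofReal_mul (Nat.cast_nonneg _), ENNReal.ofReal_natCast, ENNReal.ofReal_natCast]

end Noise

-- Removing a null set of samples

section Support

variable {Ω Z : Type*} {d P : ℕ} [MeasurableSpace Z] [DiscreteMeasurableSpace Z]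
  [mΩ : MeasurableSpace Ω] {μ : Measure Ω} {pb : Problem d P Z} {r : ℝ} {U : Ω → Draws d P Z}

open Classical in
/-- Replace a point outside the support of a distribution by a point of the support. -/
def toSupport (D : PMF Z) (z : Z) : Z :=
  if z ∈ D.support then z else D.support_nonempty.some

omit [MeasurableSpace Z] [DiscreteMeasurableSpace Z] in
lemma toSupport_mem (D : PMF Z) (z : Z) : toSupport D z ∈ D.support := by
  unfold toSupport
  split_ifs with h
  · exact h
  · exact D.support_nonempty.some_mem

omit [MeasurableSpace Z] [DiscreteMeasurableSpace Z] in
lemma toSupport_eq {D : PMF Z} {z : Z} (hz : z ∈ D.support) : toSupport D z = z := if_pos hz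

/-- The draws with all samples moved into the supports. -/
def Draws.restrict (pb : Problem d P Z) (u : Draws d P Z) : Draws d P Z :=
  { u with z := fun p i l => toSupport (pb.D p) (u.z p i l) }

lemma IsSampling.ae_mem_support (hU : IsSampling μ pb r U) :
    ∀ᵐ ω ∂μ, ∀ p i l, (U ω).z p i l ∈ (pb.D p).support := by
  simp_rw [ae_all_iff]
  intro p i l
  refine ae_of_ae_map (hU.measurable_z p i l).aemeasurable (p := (· ∈ (pb.D p).support)) ?_
  rw [hU.law_z, ae_iff]
  change (pb.D p).toMeasure (pb.D p).supportᶜ = 0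
  rw [PMF.toMeasure_apply_eq_zero_iff _ (MeasurableSet.of_discrete)]
  exact disjoint_compl_right

lemma IsSampling.ae_restrict_eq (hU : IsSampling μ pb r U) :
    ∀ᵐ ω ∂μ, (U ω).restrict pb = U ω := by
  filter_upwards [hU.ae_mem_support] with ω hω
  have : (fun p i l => toSupport (pb.D p) ((U ω).z p i l)) = (U ω).z := by
    funext p i l
    exact toSupport_eq (hω p i l)
  rw [Draws.restrict, this]

omit [DiscreteMeasurableSpace Z] in
lemma IsSampling.ae_norm_noise_le (hU : IsSampling μ pb r U) :
    ∀ᵐ ω ∂μ, ∀ i, ‖(U ω).ξ i‖ ≤ r := by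
  rw [ae_all_iff]
  intro i
  refine ae_of_ae_map (hU.measurable_ξ i).aemeasurable (p := fun v => ‖v‖ ≤ r) ?_
  rw [hU.law_ξ]
  filter_upwards [ae_cond_mem Metric.isClosed_closedBall.measurableSet] with v hv
  simpa using hv

/-- Samples lie in the supports only almost surely, while the concentration argument needs this
everywhere. Each modified sample is a function of the old one and almost surely equal to it, so
independence and laws persist. -/
lemma IsSampling.restrict (hU : IsSampling μ pb r U) :
    IsSampling μ pb r fun ω => (U ω).restrict pb where
  measurable_ξ := hU.measurable_ξ
  measurable_worker := hU.measurable_worker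
  measurable_z p i l := (Measurable.of_discrete (f := toSupport (pb.D p))).comp
    (hU.measurable_z p i l)
  law_ξ := hU.law_ξ
  law_worker := hU.law_worker
  law_z p i l := by
    rw [← hU.law_z p i l]
    refine Measure.map_congr ?_
    filter_upwards [hU.ae_mem_support] with ω hω
    exact toSupport_eq (hω p i l)
  indep := by
    refine iIndep_of_iIndep_of_le hU.indep fun s => ?_
    rcases s with i | n | ⟨p, i, l⟩
    · exact le_rfl
    · exact le_rfl
    · change MeasurableSpace.comap (toSupport (pb.D p) ∘ fun ω => (U ω).z p i l) _ ≤ _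
      rw [← MeasurableSpace.comap_comp]
      exact MeasurableSpace.comap_mono (Measurable.of_discrete (f := toSupport (pb.D p))).comap_le

end Support

-- Choice of constants

section Constants

/-- A grid size for which the union bound over iterations and grid points is affordable. -/
lemma exists_gridSize {Y G r q : ℝ} {K T S : ℕ} (hY : 3 ≤ Y) (hG : 0 ≤ G) (hr : 0 < r)
    (hq : 0 < q) (hK : (K : ℝ) ≤ Y) (hT : (T : ℝ) ≤ Y) (hS : (S : ℝ) ≤ Y) (hGY : G ≤ Y)
    (hrY : 1 / r ≤ Y) (hqY : 1 / q ≤ Y) :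
    ∃ J : ℕ, ((K * T * S : ℕ) : ℝ) * (16 * G ^ 2) + r ^ 2 / (108 * (24 * Real.log Y)) <
        r ^ 2 / (108 * (24 * Real.log Y)) * 4 ^ J ∧
      ((K * T * S : ℕ) : ℝ) * (J * (2 * Real.exp (-(24 * Real.log Y)))) ≤ 3 * q := by
  have hY0 : 0 < Y := by linarith
  have hlog : 0 < Real.log Y := Real.log_pos (by linarith)
  have hlogY : Real.log Y ≤ Y := (Real.log_le_sub_one_of_pos hY0).trans (by linarith)
  set N : ℝ := ((K * T * S : ℕ) : ℝ) with hN
  have hN0 : 0 ≤ N := Nat.cast_nonneg _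
  have hNY : N ≤ Y ^ 3 := by
    rw [hN]
    push_cast
    calc (K : ℝ) * T * S ≤ Y * Y * Y := by gcongr
      _ = Y ^ 3 := by ring
  set β := r ^ 2 / (108 * (24 * Real.log Y)) with hβ
  have hβ0 : 0 < β := by positivity
  set ρ := N * (16 * G ^ 2) / β with hρ
  have hρ0 : 0 ≤ ρ := by positivity
  -- 41472 = 16·108·24.
  have hρY : ρ ≤ 41472 * Y ^ 8 := by
    have h1 : ρ = 41472 * (N * G ^ 2 * Real.log Y * (1 / r) ^ 2) := by
      rw [hρ, hβ]
      field_simp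
      ring
    rw [h1]
    calc 41472 * (N * G ^ 2 * Real.log Y * (1 / r) ^ 2)
        ≤ 41472 * (Y ^ 3 * Y ^ 2 * Y * Y ^ 2) := by gcongr
      _ = _ := by ring
  -- A logarithmic grid would do, but n < 4ⁿ makes this cruder one work; it is only polynomial in Y.
  -- Y³ iterations and at most Y¹⁸ grid points against Y⁻²⁴ leave 2Y⁻³, and 1/q ≤ Y turns this into
  -- a multiple of q.
  refine ⟨⌊ρ⌋₊ + 2, ?_, ?_⟩
  · have h1 : ρ + 1 < 4 ^ (⌊ρ⌋₊ + 2) := by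
      have h2 : ((⌊ρ⌋₊ + 2 : ℕ) : ℝ) < 4 ^ (⌊ρ⌋₊ + 2) := by
        exact_mod_cast Nat.lt_pow_self (by norm_num : 1 < 4)
      have h3 := Nat.lt_floor_add_one ρ
      push_cast at h2
      linarith
    have h4 := mul_lt_mul_of_pos_left h1 hβ0
    have h5 : β * ρ = N * (16 * G ^ 2) := mul_div_cancel₀ _ hβ0.ne'
    linarith
  · have hexp : Real.exp (-(24 * Real.log Y)) = (Y ^ 24)⁻¹ := by
      rw [Real.exp_neg]
      congr 1
      rw [show (24 : ℝ) * Real.log Y = ((24 : ℕ) : ℝ) * Real.log Y by norm_num, Real.exp_nat_mul,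
        Real.exp_log hY0]
    have hJ : ((⌊ρ⌋₊ + 2 : ℕ) : ℝ) ≤ Y ^ 18 := by
      push_cast
      have h1 := Nat.floor_le hρ0
      -- 3¹⁰ = 59049 exceeds 41472 + 2.
      have h2 : (3 : ℝ) ^ 10 ≤ Y ^ 10 := pow_le_pow_left₀ (by norm_num) hY 10
      have h3 : (1 : ℝ) ≤ Y ^ 8 := one_le_pow₀ (by linarith)
      have h4 : Y ^ 18 = Y ^ 10 * Y ^ 8 := by ring
      nlinarith
    have hqY' : 1 ≤ q * Y := by
      rw [div_le_iff₀ hq] at hqY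
      linarith
    rw [hexp]
    calc N * (((⌊ρ⌋₊ + 2 : ℕ) : ℝ) * (2 * (Y ^ 24)⁻¹))
        ≤ Y ^ 3 * (Y ^ 18 * (2 * (Y ^ 24)⁻¹)) := by gcongr
      _ = 2 * (Y ^ 3)⁻¹ := by field_simp
      _ ≤ 2 * (Y ^ 3)⁻¹ * (q * Y) := le_mul_of_one_le_right (by positivity) hqY'
      _ = 2 * q * (Y ^ 2)⁻¹ := by field_simp
      _ ≤ 2 * q * 1 := by
          gcongr
          exact inv_le_one_of_one_le₀ (one_le_pow₀ (by linarith))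
      _ ≤ 3 * q := by linarith

/-- The four constraints on the step size. -/
lemma stepScale_bounds {L ζ η c : ℝ} {K b T P : ℕ} (hL : 0 < L) (hζ : 0 ≤ ζ) (hη : 0 < η)
    (hc : 0 < c) (h : η ≤ stepScale L ζ K b T P / c) :
    η * L ≤ 1 / c ∧ η ^ 2 * ζ ^ 2 * K ^ 2 ≤ (1 / c) ^ 2 ∧ η ^ 2 * L ^ 2 * K / b ≤ (1 / c) ^ 2 ∧
      η ^ 2 * L ^ 2 * (K * T) / (P * b) ≤ (1 / c) ^ 2 := by
  rw [stepScale] at h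
  set m := max (max L (K * ζ))
    (max (L * √((K : ℝ) / b)) (L * √((K * T : ℝ) / (P * b)))) with hm
  have h1 : L ≤ m := (le_max_left _ _).trans (le_max_left _ _)
  have h2 : K * ζ ≤ m := (le_max_right _ _).trans (le_max_left _ _)
  have h3 : L * √((K : ℝ) / b) ≤ m := (le_max_left _ _).trans (le_max_right _ _)
  have h4 : L * √((K * T : ℝ) / (P * b)) ≤ m := (le_max_right _ _).trans (le_max_right _ _)
  have hm0 : 0 < m := hL.trans_le h1
  have key : ∀ y, y ≤ m → η * y ≤ 1 / c := fun y hy => by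
    calc η * y ≤ η * m := mul_le_mul_of_nonneg_left hy hη.le
      _ ≤ m⁻¹ / c * m := mul_le_mul_of_nonneg_right h hm0.le
      _ = 1 / c := by field_simp
  have key2 : ∀ y, 0 ≤ y → y ≤ m → (η * y) ^ 2 ≤ (1 / c) ^ 2 := fun y hy0 hy =>
    pow_le_pow_left₀ (by positivity) (key y hy) 2
  refine ⟨key L h1, ?_, ?_, ?_⟩
  · calc _ = (η * (K * ζ)) ^ 2 := by ring
      _ ≤ _ := key2 _ (by positivity) h2
  · calc _ = (η * (L * √((K : ℝ) / b))) ^ 2 := by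
          rw [mul_pow, mul_pow, Real.sq_sqrt (by positivity)]
          ring
      _ ≤ _ := key2 _ (by positivity) h3
  · calc _ = (η * (L * √((K * T : ℝ) / (P * b)))) ^ 2 := by
          rw [mul_pow, mul_pow, Real.sq_sqrt (by positivity)]
          ring
      _ ≤ _ := key2 _ (by positivity) h4

/-- Subadditivity alone suffices, so the event need not be shown measurable. -/
lemma one_sub_le_measureReal {Ω : Type*} [MeasurableSpace Ω] {μ : Measure Ω}
    [IsProbabilityMeasure μ] {A : Set Ω} {c : ℝ} (hc : 0 ≤ c) (h : μ Aᶜ ≤ ENNReal.ofReal c) :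
    1 - c ≤ μ.real A := by
  have h1 : (1 : ENNReal) ≤ μ A + ENNReal.ofReal c := by
    rw [← measure_univ (μ := μ), ← Set.union_compl_self A]
    exact (measure_union_le _ _).trans (by gcongr)
  have h2 := ENNReal.toReal_mono
    (ENNReal.add_ne_top.2 ⟨measure_ne_top μ A, ENNReal.ofReal_ne_top⟩) h1
  rw [ENNReal.toReal_add (measure_ne_top μ A) ENNReal.ofReal_ne_top, ENNReal.toReal_ofReal hc,
    ENNReal.toReal_one] at h2
  rw [measureReal_def]
  linarith

end Constants

end BVR

end

theorem proposition1 :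
    ∃ cη : ℝ, 0 < cη ∧ ∃ C : ℝ, 0 < C ∧ ∃ m : ℕ,
      ∀ (d P K b T S : ℕ), 0 < P → 0 < K → 0 < b → 0 < T →
      ∀ (L ζ G r q : ℝ), 0 < L → 0 < r → 0 < q → q < 1 →
      ∀ (Z : Type*) [MeasurableSpace Z] [DiscreteMeasurableSpace Z] (pb : BVR.Problem d P Z),
        pb.Offline → pb.Heterogeneous ζ → pb.LossGradLipschitz L → pb.HasMinimizer →
        pb.LossGradBounded G →
      ∀ (η : ℝ), 0 < η →
        η ≤ BVR.stepScale L ζ K b T P / (C * BVR.logFactor L G K b T S r q ^ m) →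
      ∀ (x₀ : BVR.Vec d) (Ω : Type*) [MeasurableSpace Ω] (μ : MeasureTheory.Measure Ω)
        [MeasureTheory.IsProbabilityMeasure μ] (U : Ω → BVR.Draws d P Z),
        BVR.IsSampling μ pb r U →
        1 - 3 * q ≤ μ.real {ω | ∀ k₀ t₀ s₀ k t s : ℕ,
          k₀ ≤ K → t₀ < T → s₀ < S → k ≤ K → t < T → s < S →
          BVR.idx K T k₀ t₀ s₀ ≤ BVR.idx K T k t s →
          BVR.DescentIneq pb.obj
            (BVR.iterate pb { x₀ := x₀, η := η, b := b, K := K, T := T } (U ω))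
            η r cη K T k₀ t₀ s₀ k t s} := by
  -- With l = 24Λ and ε = 1/(300Λ)², the condition (108l + 3)ε ≤ 1/16 holds because Λ ≥ 1 and
  -- 2595/90000 < 1/16. The leftover coefficients are at most 1/8, so cη = 1 suffices.
  refine ⟨1, one_pos, 300, by norm_num, 1, ?_⟩
  intro d P K b T S hP hK hb hT L ζ G r q hL hr hq _ Z _ _ pb hoff hhet hlip _ hG η hη hstep
    x₀ Ω _ μ _ U hU
  have hG0 : 0 ≤ G := BVR.gradBound_nonneg hP hG
  have hζ : 0 ≤ ζ := (norm_nonneg _).trans (hhet.2 ⟨0, hP⟩ ⟨0, hP⟩ 0)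
  rw [pow_one, BVR.logFactor] at hstep
  set Y : ℝ := 3 + L + G + K + b + T + S + 1 / r + 1 / q with hYdef
  have hr' : 0 < 1 / r := by positivity
  have hq' : 0 < 1 / q := by positivity
  have hK' : (0 : ℝ) ≤ K := Nat.cast_nonneg K
  have hb' : (0 : ℝ) ≤ b := Nat.cast_nonneg b
  have hT' : (0 : ℝ) ≤ T := Nat.cast_nonneg T
  have hS' : (0 : ℝ) ≤ S := Nat.cast_nonneg S
  have hY : 3 ≤ Y := by linarith
  have hΛ : 1 ≤ Real.log Y := by
    rw [Real.le_log_iff_exp_le (by linarith)]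
    linarith [Real.exp_one_lt_d9]
  obtain ⟨J, hJ, hJq⟩ := BVR.exists_gridSize (Y := Y) (G := G) (K := K) (T := T) (S := S) hY hG0 hr
    hq (by linarith) (by linarith) (by linarith) (by linarith) (by linarith) (by linarith)
  obtain ⟨hεL, hεζ, hεb, hεP⟩ := BVR.stepScale_bounds hL hζ hη (by positivity) hstep
  set a : BVR.Params d := { x₀ := x₀, η := η, b := b, K := K, T := T } with ha
  have hnoise := BVR.measure_noise_gt_le (a := a) hU.restrict hoff hlip hG
    (fun ω p i l => BVR.toSupport_mem _ _) hP hK hb hL.le (l := 24 * Real.log Y) (by positivity)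
    (β := r ^ 2 / (108 * (24 * Real.log Y))) (by positivity) hJ
  refine BVR.one_sub_le_measureReal (by positivity) ((MeasureTheory.measure_mono_ae ?_).trans
    (hnoise.trans (ENNReal.ofReal_le_ofReal hJq)))
  -- By contraposition: outside a null set, a failure of descent forces a failure of the noise bound
  -- for the restricted draws, which there coincide with the original ones.
  filter_upwards [hU.ae_restrict_eq, hU.ae_norm_noise_le] with ω hω hξ hbad hgood
  rw [hω] at hgood
  refine hbad fun k₀ t₀ s₀ k t s _ _ _ hk ht hs hle => ?_
  refine BVR.descentIneq_of_noise_le (a := a) (S := S) hP hK hb hT hL.le hG0 hη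
    (l := 24 * Real.log Y) (by positivity) hoff hlip hhet
    (β := r ^ 2 / (108 * (24 * Real.log Y)))
    (ε := (1 / (300 * Real.log Y)) ^ 2) (le_of_eq (mul_div_cancel₀ _ (by positivity)))
    (hεL.trans ?_) hεζ hεb hεP ?_ hξ hgood hk ht hs hle
  · rw [div_le_div_iff₀ (by positivity) (by norm_num)]
    linarith
  · rw [div_pow, one_pow, mul_one_div, div_le_div_iff₀ (by positivity) (by norm_num)]
    nlinarith
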